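/- Let $q$ be a power of $2$, let $m\ge 2$, and let $M(x)\in\mathbb F_q[x]$ be a monic polynomial of degree $2m$ with $M(0)\ne 0$ that is self-reciprocal, i.e. $M(x)=M(0)^{-1}x^{2m}M(1/x)$. Suppose that $1$ is a root of $M$ of multiplicity exactly two and that all roots of $M(x)/(x-1)^2$ in an algebraic closure of $\mathbb F_q$ are simple. Write $M(x)=\sum_{i=0}^{2m}c_ix^i$; then $c_0=c_{2m}=1$, $c_i=c_{2m-i}$ for $0\le i\le 2m$, and $c_m=0$. Put $$\Phi(x)=\sum_{i=0}^{2m}c_ix^{q^i}\in\mathbb F_q[x],\qquad L(x)=\Phi(x)+t^q x^{q^{m+1}}+t\,x^{q^{m-1}}\in\mathbb F_q(t)[x].$$ Let $E$ be a splitting field of $L$ over $\mathbb F_q(t)$ and let $V\subset E$ be the set of roots of $L$, which is an $\mathbb F_q$-subspace of $E$. Then $E/\mathbb F_q(t)$ is a Galois extension, and its Galois group $G$ acts faithfully on $V$ by $\mathbb F_q$-linear automorphisms. Moreover, $\dim_{\mathbb F_q}V=2m$, and there is a quadratic form $Q:V\to\mathbb F_q$ with nondegenerate polarization $Q(u+w)-Q(u)-Q(w)$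 and with exactly $(q^{m-1}-1)(q^m+1)$ nonzero vectors $v$ satisfying $Q(v)=0$ (a form of minus type, so that its isometry group is $O^-(2m,q)$), such that the following hold. 1. The set of Frobenius elements of $G$ at the degree one prime $(t)$ of $\mathbb F_q[t]$ is a conjugacy class of $G$, and every element of it has a power that acts on $V$ as an orthogonal transvection. Here $\sigma\in G$ is a Frobenius element at $(t)$ if $\sigma(z)\equiv z^q \pmod J$ for all $z\in R$, for some prime ideal $J$ lying over $(t)$ of the integral closure $R$ of $\mathbb F_q[t]$ in $E$; and an orthogonal transvection is an isometry $g$ of $Q$ whose minimal polynomial is $(x-1)^2$ and for which $g-1$ has rank one. 2. The image of $G$ in $GL(V)$ is the full isometry group of $Q$; thus $G$ is $O^-(2m,q)$. -/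

import Mathlib

open Polynomial

noncomputable section

namespace OrthGal

/-! ### Self-reciprocal polynomials -/

/-- `g*(x) = g(0)⁻¹ x^d g(1/x)`, where `d = deg g`. -/
def reciprocal {F : Type*} [Field F] (g : F[X]) : F[X] :=
  C (g.eval 0)⁻¹ * g.reverse

/-- A polynomial `g` with `g(0) ≠ 0` is self-reciprocal if `g = g*`. -/
def IsSelfReciprocal {F : Type*} [Field F] (g : F[X]) : Prop :=
  g.eval 0 ≠ 0 ∧ g = reciprocal g

/-- All roots of `g` in an algebraic closure of `F` are simple. -/
def HasSimpleRoots {F : Type*} [Field F] (g : F[X]) : Prop :=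
  (g.map (algebraMap F (AlgebraicClosure F))).roots.Nodup

/-! ### `q`-polynomials and their spaces of roots -/

/-- A polynomial in which only the monomials `x, x^q, x^(q^2), …` occur. -/
def IsQPolynomial {K : Type*} [Semiring K] (q : ℕ) (P : K[X]) : Prop :=
  ∀ i ∈ P.support, ∃ j : ℕ, i = q ^ j

/-- The `q`-polynomial `∑ cᵢ x^(q^i)` with conventional associate `M = ∑ cᵢ x^i`. -/
def qAssociate {F : Type*} [Semiring F] (q : ℕ) (M : F[X]) : F[X] :=
  ∑ i ∈ Finset.range (M.natDegree + 1), monomial (q ^ i) (M.coeff i)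

/-- `L = Φ + t^q x^(q^(m+1)) + t x^(q^(m-1))` over `F(t)`, where `q = |F|` and `Φ` is the
`q`-polynomial with conventional associate `M`. -/
def polyL {F : Type*} [Field F] (m : ℕ) (M : F[X]) : (RatFunc F)[X] :=
  (qAssociate (Nat.card F) M).map (algebraMap F (RatFunc F)) +
    C (RatFunc.X ^ Nat.card F) * X ^ (Nat.card F ^ (m + 1)) +
    C RatFunc.X * X ^ (Nat.card F ^ (m - 1))

section Helpers

variable {K : Type*} [Semiring K] {q : ℕ}

theorem IsQPolynomial.add {P R : K[X]} (hP : IsQPolynomial q P) (hR : IsQPolynomial q R) :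
    IsQPolynomial q (P + R) := fun i hi => by
  rcases Finset.mem_union.1 (support_add hi) with h | h
  exacts [hP i h, hR i h]

theorem isQPolynomial_monomial (j : ℕ) (a : K) : IsQPolynomial q (monomial (q ^ j) a) :=
  fun i hi => ⟨j, by simpa using support_monomial_subset _ _ hi⟩

theorem isQPolynomial_qAssociate (M : K[X]) : IsQPolynomial q (qAssociate q M) := by
  unfold qAssociate
  refine Finset.sum_induction _ (IsQPolynomial q) (fun _ _ => IsQPolynomial.add) ?_
    fun i _ => isQPolynomial_monomial i _
  intro i hi
  simp at hi

theorem isQPolynomial_polyL {F : Type*} [Field F] (m : ℕ) (M : F[X]) :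
    IsQPolynomial (Nat.card F) (polyL m M) := by
  refine IsQPolynomial.add (IsQPolynomial.add ?_ ?_) ?_
  · exact fun i hi => isQPolynomial_qAssociate M i (support_map_subset _ _ hi)
  · rw [C_mul_X_pow_eq_monomial]; exact isQPolynomial_monomial _ _
  · rw [C_mul_X_pow_eq_monomial]; exact isQPolynomial_monomial _ _

theorem pow_card_pow_add {F E : Type*} [Field F] [Finite F] [Field E] [Algebra F E] (j : ℕ)
    (a b : E) : (a + b) ^ (Nat.card F ^ j) = a ^ (Nat.card F ^ j) + b ^ (Nat.card F ^ j) := by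
  have := Fintype.ofFinite F
  rw [Nat.card_eq_fintype_card]
  induction j with
  | zero => simp
  | succ j ih =>
    rw [pow_succ, pow_mul, pow_mul, pow_mul, ih]
    exact map_add (FiniteField.frobeniusAlgHom F E) _ _

theorem pow_card_pow_smul {F E : Type*} [Field F] [Finite F] [Field E] [Algebra F E] (j : ℕ)
    (c : F) (a : E) : (c • a) ^ (Nat.card F ^ j) = c • a ^ (Nat.card F ^ j) := by
  have := Fintype.ofFinite F
  rw [Nat.card_eq_fintype_card, _root_.smul_pow, FiniteField.pow_card_pow]

end Helpers

/-- The space of roots in `E` of a `q`-polynomial over `K`, as an `F`-subspace of `E`, where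
`q = |F|`. -/
def rootSpace (F : Type*) {K : Type*} (E : Type*) [Field F] [Finite F] [Field K] [Field E]
    [Algebra K E] [Algebra F E] (P : K[X]) (hP : IsQPolynomial (Nat.card F) P) :
    Submodule F E where
  carrier := {α | aeval α P = 0}
  zero_mem' := by
    rw [Set.mem_ofPred_eq, aeval_eq_sum_range]
    refine Finset.sum_eq_zero fun i _ => ?_
    by_cases h : i ∈ P.support
    · obtain ⟨j, rfl⟩ := hP i h
      rw [zero_pow (pow_ne_zero _ Nat.card_pos.ne'), smul_zero]
    · rw [notMem_support_iff.1 h, zero_smul]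
  add_mem' := by
    intro a b ha hb
    have key : aeval (a + b) P = aeval a P + aeval b P := by
      simp only [aeval_def, eval₂_eq_sum, Polynomial.sum, ← Finset.sum_add_distrib]
      refine Finset.sum_congr rfl fun i hi => ?_
      obtain ⟨j, rfl⟩ := hP i hi
      rw [pow_card_pow_add, mul_add]
    rw [Set.mem_ofPred_eq] at ha hb ⊢
    rw [key, ha, hb, add_zero]
  smul_mem' := by
    intro c a ha
    have key : aeval (c • a) P = c • aeval a P := by
      simp only [aeval_def, eval₂_eq_sum, Polynomial.sum, Finset.smul_sum]
      refine Finset.sum_congr rfl fun i hi => ?_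
      obtain ⟨j, rfl⟩ := hP i hi
      rw [pow_card_pow_smul, mul_smul_comm]
    rw [Set.mem_ofPred_eq] at ha ⊢
    rw [key, ha, smul_zero]

/-- The action of `Gal(E/K)` on the space of roots of a `q`-polynomial over `K` by `F`-linear
automorphisms. -/
def rootRep (F : Type*) {K : Type*} (E : Type*) [Field F] [Finite F] [Field K] [Field E]
    [Algebra F K] [Algebra K E] [Algebra F E] [IsScalarTower F K E]
    (P : K[X]) (hP : IsQPolynomial (Nat.card F) P) :
    (E ≃ₐ[K] E) →* (rootSpace F E P hP ≃ₗ[F] rootSpace F E P hP) where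
  toFun σ :=
    { toFun := fun v => ⟨σ v, by
        have hv : aeval (v : E) P = 0 := v.2
        change aeval (σ (v : E)) P = 0
        rw [aeval_algHom_apply, hv, map_zero]⟩
      invFun := fun v => ⟨σ.symm v, by
        have hv : aeval (v : E) P = 0 := v.2
        change aeval (σ.symm (v : E)) P = 0
        rw [aeval_algHom_apply, hv, map_zero]⟩
      map_add' := fun v w => Subtype.ext (map_add σ (v : E) (w : E))
      map_smul' := fun c v => Subtype.ext (map_smul (σ.restrictScalars F) c (v : E))
      left_inv := fun v => Subtype.ext (σ.symm_apply_apply (v : E))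
      right_inv := fun v => Subtype.ext (σ.apply_symm_apply (v : E)) }
  map_one' := rfl
  map_mul' _ _ := rfl

/-! ### Frobenius classes at primes of degree one -/

/-- The Frobenius elements of `Gal(E/F(t))` at the prime `(t - a)` of `F[t]`: those `σ` for which
there is a prime ideal `J` of the integral closure `R` of `F[t]` in `E`, lying over `(t - a)`, with
`σ z ≡ z ^ |F[t]/(t - a)|` modulo `J` for all `z ∈ R`. -/
def frobeniusClass (F E : Type*) [Field F] [Field E] [Algebra (RatFunc F) E] [Algebra F[X] E]
    [IsScalarTower F[X] (RatFunc F) E] (a : F) : Set (E ≃ₐ[RatFunc F] E) :=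
  {σ | ∃ J : Ideal (integralClosure F[X] E), J.IsPrime ∧ J.under F[X] = Ideal.span {X - C a} ∧
    ((σ.restrictScalars F[X]).mapIntegralClosure.toAlgHom).IsArithFrobAt J}

/-! ### Orthogonal groups -/

section Orthogonal

variable {F V : Type*} [Field F] [AddCommGroup V] [Module F V]

/-- The orthogonal group of a quadratic form: the group of its linear isometries. -/
def orthogonalGroup (Q : QuadraticForm F V) : Subgroup (V ≃ₗ[F] V) where
  carrier := {g | ∀ v, Q (g v) = Q v}
  one_mem' _ := rfl
  mul_mem' {g h} hg hh v := (hg (h v)).trans (hh v)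
  inv_mem' {g} hg v := by
    rw [← hg (g⁻¹ v)]
    exact congrArg Q (g.apply_symm_apply v)

/-- `Q` is a quadratic form of minus type in dimension `2m` over a finite field with `q` elements:
its polarization is nondegenerate, and it has exactly `(q^(m-1) - 1)(q^m + 1)` nonzero isotropic
vectors. The orthogonal group of such a form is `O⁻(2m, q)`. -/
structure IsMinusType (m : ℕ) (Q : QuadraticForm F V) : Prop where
  finrank_eq : Module.finrank F V = 2 * m
  nondegenerate : (QuadraticMap.polarBilin Q).Nondegenerate
  card_isotropic : {v : V | v ≠ 0 ∧ Q v = 0}.ncard =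
    (Nat.card F ^ (m - 1) - 1) * (Nat.card F ^ m + 1)

/-- An orthogonal transvection: an isometry `g` of `Q` with minimal polynomial `(x - 1)^2` and
`g - 1` of rank one. -/
def IsOrthogonalTransvection (Q : QuadraticForm F V) (g : V ≃ₗ[F] V) : Prop :=
  g ∈ orthogonalGroup Q ∧ minpoly F (g : Module.End F V) = (X - 1) ^ 2 ∧
    Module.finrank F (LinearMap.range ((g : Module.End F V) - 1)) = 1

end Orthogonal

end OrthGal

end

/-!
Write `q = |F|` and let `τ` be the `q`-power map. The coefficients of `L` are symmetric in the sense
that the operator `τ^(-m) L` is self-adjoint, and its middle coefficient vanishes. In characteristic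
two this makes `u^(q^m) L(u)` equal to `Q(u)^q - Q(u)` for an explicit quadratic map `Q` on `E`
(`formE_pow_card_sub`), namely `Q(u) = t u^(q^(m-1) + q^m) + A(u)` with `A` in `F[u]`. So `Q` takes
values in `F` on the space `V` of roots of `L`, and it is a Galois invariant quadratic form there.

*Minus type.* The equation `Q(u) = a` has degree `q^(2m-1) + q^(m-1)` in `u`, and for `a = 0` its
left side is divisible by `u^(q^m + 1)`. The resulting upper bounds for the numbers of solutions add
up to `|V| = q^(2m)`, so all of them are attained (`ncard_isotropic`). The polarization is
nondegenerate because `B(u, w)` has degree `q^(2m-1) < |V|` in `u`.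

*Transitivity.* The equation `Q(u) = 1` is linear in `t`, hence irreducible over `F(t)` by Gauss's
lemma, so the Galois group permutes transitively the vectors of `V` with `Q(v) = 1`
(`exists_rootRep_apply_eq`). In characteristic two every nonsingular vector is a multiple of such a
vector, so as soon as the image of the Galois group contains one reflection it contains all.

*Frobenius elements.* Modulo a prime `J` over `(t)`, `L` becomes `Φ`, which is separable, so `V` is
mapped injectively to the residue field and a Frobenius element `σ` acts on `V` as `τ` acts on the
roots of `Φ`. This determines `σ` from `J`, and primes over `(t)` are conjugate, so the Frobenius
elements form a conjugacy class (`exists_conjClasses_carrier_eq`). Counting roots of `q`-polynomials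
shows that `σ` has minimal polynomial `M = (x - 1) D` on `V`, with `D` separable and `D(1) = 0`, and
that the fixed space of `σ` is a line. If `k` is odd with `D ∣ x^k - 1`, then `σ^k` is a
transvection (`exists_pow_transvection`), and an isometry `g` with `g - 1` of rank one is a reflection.

*Generation.* In characteristic two, a nondegenerate quadratic space in which every totally singular
subspace has less than half the dimension has its orthogonal group generated by reflections
(`orthogonalGroup_le_of_reflectionOf_mem`), and the number of isotropic vectors of a form of minus
type excludes totally singular subspaces of dimension `m` (`IsMinusType.two_mul_finrank_lt`).
-/

namespace OrthGal

/-! ### Reflections and generation of the orthogonal group in characteristic two -/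

section QuadraticSpace

variable {F V : Type*} [Field F] [AddCommGroup V] [Module F V] {Q : QuadraticForm F V}

open QuadraticMap

theorem polar_self_eq (Q : QuadraticForm F V) (a : V) : polar Q a a = 2 * Q a := by
  simp [QuadraticMap.polar_self]

theorem map_sub_smul (Q : QuadraticForm F V) (v a : V) (c : F) :
    Q (v - c • a) = Q v + c * c * Q a - c * polar Q v a := by
  rw [sub_eq_add_neg, ← neg_smul, QuadraticMap.map_add (f := Q), QuadraticMap.map_smul,
    polar_smul_right]
  simp only [smul_eq_mul]; ring

theorem map_sub_eq (Q : QuadraticForm F V) (v a : V) :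
    Q (v - a) = Q v + Q a - polar Q v a := by
  simpa using map_sub_smul Q v a 1

/-- The reflection in a nonsingular vector `a` (that is, `Q a ≠ 0`) of a quadratic space. In characteristic two it is
the orthogonal transvection `v ↦ v + (B(v, a) / Q(a)) a`. -/
noncomputable def reflectionOf (Q : QuadraticForm F V) (a : V) (ha : Q a ≠ 0) : V ≃ₗ[F] V :=
  Module.reflection (f := (Q a)⁻¹ • polarBilin Q a) (x := a) (by
    simp only [LinearMap.smul_apply, polarBilin_apply_apply, polar_self_eq, smul_eq_mul]
    field_simp)

theorem reflectionOf_apply (a : V) (ha : Q a ≠ 0) (v : V) :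
    reflectionOf Q a ha v = v - (polar Q v a / Q a) • a := by
  rw [reflectionOf, Module.reflection_apply]
  simp only [LinearMap.smul_apply, polarBilin_apply_apply, smul_eq_mul]
  rw [polar_comm, div_eq_inv_mul]

theorem reflectionOf_mem (a : V) (ha : Q a ≠ 0) : reflectionOf Q a ha ∈ orthogonalGroup Q := by
  intro v
  rw [reflectionOf_apply, map_sub_smul]
  field_simp
  ring

theorem polar_map_of_mem {g : V ≃ₗ[F] V} (hg : g ∈ orthogonalGroup Q) (v w : V) :
    polar Q (g v) (g w) = polar Q v w := by
  simp only [polar, ← map_add]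
  rw [hg, hg, hg]

theorem reflectionOf_smul {a : V} (ha : Q a ≠ 0) {c : F} (hc : c ≠ 0) (hca : Q (c • a) ≠ 0) :
    reflectionOf Q (c • a) hca = reflectionOf Q a ha := by
  ext v
  rw [reflectionOf_apply, reflectionOf_apply, QuadraticMap.polar_smul_right, QuadraticMap.map_smul,
    smul_smul, smul_eq_mul, smul_eq_mul]
  congr 2
  field_simp

theorem conj_reflectionOf {a b : V} (ha : Q a ≠ 0) (hb : Q b ≠ 0) {g : V ≃ₗ[F] V}
    (hg : g ∈ orthogonalGroup Q) (hab : g a = b) : g * reflectionOf Q a ha * g⁻¹ = reflectionOf Q b hb := by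
  subst hab
  rw [mul_inv_eq_iff_eq_mul]
  ext v
  simp only [LinearEquiv.mul_apply, reflectionOf_apply, map_sub, map_smul]
  rw [polar_map_of_mem hg, hg]

/-- The vectors fixed by `g`. -/
def fixedSpace (g : V ≃ₗ[F] V) : Submodule F V := LinearMap.ker ((g : V →ₗ[F] V) - LinearMap.id)

theorem mem_fixedSpace {g : V ≃ₗ[F] V} {v : V} : v ∈ fixedSpace g ↔ g v = v := by
  simp [fixedSpace, sub_eq_zero]

theorem polar_sub_eq_zero {g : V ≃ₗ[F] V} (hg : g ∈ orthogonalGroup Q) (v : V) {w : V}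
    (hw : g w = w) : polar Q (g v - v) w = 0 := by
  rw [polar_sub_left, sub_eq_zero]
  nth_rw 1 [← hw]
  exact polar_map_of_mem hg v w

/-- If `g v - v` is nonsingular, the reflection in it sends `g v` back to `v`. -/
theorem reflectionOf_map_sub {g : V ≃ₗ[F] V} (hg : g ∈ orthogonalGroup Q) (v : V)
    (h : Q (g v - v) ≠ 0) : reflectionOf Q _ h (g v) = v := by
  have : polar Q (g v) (g v - v) = Q (g v - v) := by
    rw [polar_sub_right, polar_self_eq, map_sub_eq, hg]; ring
  rw [reflectionOf_apply, this, div_self h, one_smul, sub_sub_cancel]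

theorem reflectionOf_map_fixed {g : V ≃ₗ[F] V} (hg : g ∈ orthogonalGroup Q) (v : V)
    (h : Q (g v - v) ≠ 0) {w : V} (hw : g w = w) : reflectionOf Q _ h (g w) = w := by
  rw [hw, reflectionOf_apply, polar_comm, polar_sub_eq_zero hg v hw]
  simp

theorem sup_span_le_fixedSpace {g : V ≃ₗ[F] V} (hg : g ∈ orthogonalGroup Q) (v : V)
    (h : Q (g v - v) ≠ 0) :
    fixedSpace g ⊔ Submodule.span F {v} ≤ fixedSpace (reflectionOf Q _ h * g) := by
  refine sup_le (fun w hw => ?_) ((Submodule.span_singleton_le_iff_mem _ _).2 ?_)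
  · exact mem_fixedSpace.2 (reflectionOf_map_fixed hg v h (mem_fixedSpace.1 hw))
  · exact mem_fixedSpace.2 (reflectionOf_map_sub hg v h)

theorem finrank_lt_finrank_sup_span [FiniteDimensional F V] (W : Submodule F V) {v : V}
    (hv : v ∉ W) : Module.finrank F W < Module.finrank F ↥(W ⊔ Submodule.span F {v}) := by
  refine Submodule.finrank_lt_finrank_of_lt (lt_of_le_of_ne le_sup_left fun h => hv ?_)
  rw [h]
  exact Submodule.mem_sup_right (Submodule.mem_span_singleton_self v)

theorem exists_polar_ne_zero (hQ : (polarBilin Q).Nondegenerate) {a : V} (ha : a ≠ 0) :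
    ∃ u, polar Q u a ≠ 0 := by
  by_contra! h
  exact ha (hQ.2 a fun u => h u)

/-- Two proper subspaces do not cover a vector space. -/
theorem exists_notMem_of_two (W W' : Submodule F V) (h : ∃ v, v ∉ W) (h' : ∃ v, v ∉ W') :
    ∃ v, v ∉ W ∧ v ∉ W' := by
  obtain ⟨v, hv⟩ := h
  obtain ⟨w, hw⟩ := h'
  by_cases hv' : v ∈ W'
  · by_cases hw' : w ∈ W
    · exact ⟨v + w, fun h => hv ((W.add_mem_iff_left hw').1 h),
        fun h => hw ((W'.add_mem_iff_right hv').1 h)⟩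
    · exact ⟨w, hw', hw⟩
  · exact ⟨v, hv, hv'⟩

/-- If every `g v - v` is singular although `g` is not the identity, then multiplying `g` by two
reflections, the first of them in a vector fixed by `g`, gives an isometry with a fixed space at
least as large and with a nonsingular vector of the form `g₂ u - u`. -/
theorem exists_reflections_nonsingular [CharP F 2] [FiniteDimensional F V]
    (hQ : (polarBilin Q).Nondegenerate)
    {g : V ≃ₗ[F] V} (hg : g ∈ orthogonalGroup Q) (hsing : ∀ v, Q (g v - v) = 0)
    (hne : ∃ v, g v ≠ v) {a : V} (hga : g a = a) (ha : Q a ≠ 0) :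
    ∃ (x : V) (hx : Q x ≠ 0) (u : V),
      Module.finrank F (fixedSpace g) ≤
        Module.finrank F (fixedSpace (reflectionOf Q x hx * (reflectionOf Q a ha * g))) ∧
      Q ((reflectionOf Q x hx * (reflectionOf Q a ha * g)) u - u) ≠ 0 := by
  have ha0 : a ≠ 0 := by rintro rfl; simp at ha
  have two : (2 : F) = 0 := CharTwo.two_eq_zero
  let W' : Submodule F V := LinearMap.ker (polarBilin Q a)
  have hW' : ∀ w, w ∈ W' ↔ polar Q w a = 0 := fun w => by
    rw [LinearMap.mem_ker, polarBilin_apply_apply, polar_comm]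
  -- a vector moved by `g` and not orthogonal to `a`
  obtain ⟨v, hv, hva⟩ := exists_notMem_of_two (fixedSpace g) W'
    (by simpa only [mem_fixedSpace] using hne)
    (by simpa only [hW'] using exists_polar_ne_zero hQ ha0)
  rw [mem_fixedSpace] at hv
  rw [hW'] at hva
  have hg1 : reflectionOf Q a ha * g ∈ orthogonalGroup Q :=
    mul_mem (reflectionOf_mem a ha) hg
  have pga : ∀ w, polar Q (g w) a = polar Q w a := fun w => by
    nth_rw 1 [← hga]; exact polar_map_of_mem hg w a
  have hg1v : ∀ w, (reflectionOf Q a ha * g) w = g w - (polar Q w a / Q a) • a := fun w => by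
    rw [LinearEquiv.mul_apply, reflectionOf_apply, pga]
  set c := polar Q v a / Q a with hc
  have hc0 : c ≠ 0 := div_ne_zero hva ha
  have hi0 : g v - v ≠ 0 := sub_ne_zero.2 hv
  have hxeq : (reflectionOf Q a ha * g) v - v = (g v - v) - c • a := by rw [hg1v]; abel
  have hxQ : Q ((reflectionOf Q a ha * g) v - v) = c * c * Q a := by
    rw [hxeq, map_sub_smul, hsing, polar_sub_eq_zero hg v hga]; ring
  have hx : Q ((reflectionOf Q a ha * g) v - v) ≠ 0 := by
    rw [hxQ]; exact mul_ne_zero (mul_ne_zero hc0 hc0) ha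
  obtain ⟨u', hu'⟩ := exists_polar_ne_zero hQ hi0
  obtain ⟨u, rfl⟩ := g.surjective u'
  refine ⟨_, hx, u, ?_, ?_⟩
  -- the second reflection regains in `v` the dimension that the first one loses
  · have h1 : (fixedSpace g ⊓ W') ⊔ Submodule.span F {v} ≤
        fixedSpace (reflectionOf Q _ hx * (reflectionOf Q a ha * g)) := by
      refine le_trans (sup_le_sup_right ?_ _) (sup_span_le_fixedSpace hg1 v hx)
      rintro w ⟨hw, hw'⟩
      rw [SetLike.mem_coe, mem_fixedSpace] at hw
      rw [SetLike.mem_coe, hW'] at hw'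
      rw [mem_fixedSpace, hg1v, hw, hw', zero_div, zero_smul, sub_zero]
    have h2 := Submodule.finrank_mono h1
    have h3 := finrank_lt_finrank_sup_span (fixedSpace g ⊓ W') (v := v)
      (fun h => hv (mem_fixedSpace.1 h.1))
    have h4 := Submodule.finrank_sup_add_finrank_inf_eq (fixedSpace g) W'
    have h5 : Module.finrank F V ≤ Module.finrank F W' + 1 := by
      have := LinearMap.finrank_range_add_finrank_ker (polarBilin Q a)
      have h6 : Module.finrank F (LinearMap.range (polarBilin Q a)) ≤ 1 :=
        (Submodule.finrank_le _).trans (Module.finrank_self F).le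
      change _ + Module.finrank F W' = _ at this
      omega
    have h7 := Submodule.finrank_le (fixedSpace g ⊔ W')
    omega
  · -- modulo the singular space `range (g - 1)` the vector `g₂ u - u` is a nonzero multiple of `a`
    set x := (reflectionOf Q a ha * g) v - v with hxdef
    have hpx : polar Q ((reflectionOf Q a ha * g) u) x =
        polar Q (g u) (g v - v) - c * polar Q u a := by
      rw [hg1v, hxeq, polar_sub_left, polar_sub_right (x := g u), polar_smul_right,
        polar_smul_left, polar_sub_right (x := a), polar_smul_right, polar_self_eq, pga,
        polar_comm Q a (g v - v), polar_sub_eq_zero hg v hga, two]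
      simp
    set d := polar Q (g u) (g v - v) with hd
    set e := polar Q ((reflectionOf Q a ha * g) u) x / Q x with he
    have key : (reflectionOf Q x hx * (reflectionOf Q a ha * g)) u - u =
        (g (u - e • v) - (u - e • v)) - (-(d / (c * Q a))) • a := by
      have hcoef : polar Q u a / Q a - e * c = -(d / (c * Q a)) := by
        rw [he, hpx, hxQ]
        have : polar Q u a / Q a = -(polar Q u a / Q a) := by
          rw [eq_neg_iff_add_eq_zero, ← two_mul, two, zero_mul]
        rw [this]
        field_simp
        ring
      rw [← hcoef, LinearEquiv.mul_apply, reflectionOf_apply, ← he, hxeq, hg1v, map_sub, map_smul]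
      module
    rw [key, map_sub_smul, hsing, polar_sub_eq_zero hg _ hga]
    have : d / (c * Q a) ≠ 0 := div_ne_zero hu' (mul_ne_zero hc0 ha)
    simpa using ⟨⟨hu', hc0, ha⟩, ha⟩

/-- In characteristic two, if the totally singular subspaces of a nondegenerate quadratic space all
have less than half of its dimension, then its orthogonal group is generated by the reflections. -/
theorem orthogonalGroup_le_of_reflectionOf_mem [CharP F 2] [FiniteDimensional F V]
    (hQ : (polarBilin Q).Nondegenerate)
    (hW : ∀ S : Submodule F V, (∀ s ∈ S, Q s = 0) → 2 * Module.finrank F S < Module.finrank F V)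
    (H : Subgroup (V ≃ₗ[F] V)) (hH : ∀ a ha, reflectionOf Q a ha ∈ H) :
    orthogonalGroup Q ≤ H := by
  suffices ∀ n, ∀ g ∈ orthogonalGroup Q,
      Module.finrank F V - Module.finrank F (fixedSpace g) ≤ n → g ∈ H from
    fun g hg => this _ g hg le_rfl
  intro n
  -- an isometry moving some vector by a nonsingular one is handled by a single reflection
  have step : ∀ n, (∀ g ∈ orthogonalGroup Q,
      Module.finrank F V - Module.finrank F (fixedSpace g) ≤ n → g ∈ H) →
      ∀ g ∈ orthogonalGroup Q, Module.finrank F V - Module.finrank F (fixedSpace g) ≤ n + 1 →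
      ∀ v, Q (g v - v) ≠ 0 → g ∈ H := by
    intro n ih g hg hn v hv
    have hlt : Module.finrank F (fixedSpace g) <
        Module.finrank F (fixedSpace (reflectionOf Q _ hv * g)) := by
      refine (finrank_lt_finrank_sup_span _ (v := v) fun h => hv ?_).trans_le
        (Submodule.finrank_mono (sup_span_le_fixedSpace hg v hv))
      rw [mem_fixedSpace.1 h, sub_self, QuadraticMap.map_zero]
    have := ih _ (mul_mem (reflectionOf_mem _ hv) hg) (by omega)
    exact (Subgroup.mul_mem_cancel_left _ (hH _ hv)).1 this
  induction n with
  | zero =>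
    intro g hg hn
    have : fixedSpace g = ⊤ := by
      refine Submodule.eq_top_of_finrank_eq (le_antisymm (Submodule.finrank_le _) (by omega))
    have : g = 1 := LinearEquiv.ext fun v => mem_fixedSpace.1 (this ▸ Submodule.mem_top)
    exact this ▸ one_mem H
  | succ n ih =>
    intro g hg hn
    by_cases h1 : ∃ v, Q (g v - v) ≠ 0
    · obtain ⟨v, hv⟩ := h1
      exact step n ih g hg hn v hv
    push Not at h1
    by_cases h2 : ∃ v, g v ≠ v
    swap
    · push Not at h2
      have : g = 1 := LinearEquiv.ext h2
      exact this ▸ one_mem H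
    -- the fixed space and `range (g - 1)` cannot both be totally singular
    obtain ⟨a, hga, ha⟩ : ∃ a, g a = a ∧ Q a ≠ 0 := by
      by_contra! h
      have e1 := hW (fixedSpace g) fun s hs => h s (mem_fixedSpace.1 hs)
      have e2 := hW (LinearMap.range ((g : V →ₗ[F] V) - LinearMap.id)) (by
        rintro _ ⟨v, rfl⟩
        exact h1 v)
      have e3 := LinearMap.finrank_range_add_finrank_ker ((g : V →ₗ[F] V) - LinearMap.id)
      change _ + Module.finrank F (fixedSpace g) = _ at e3
      omega
    obtain ⟨x, hx, u, hle, hu⟩ := exists_reflections_nonsingular hQ hg h1 h2 hga ha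
    have := step n ih _ (mul_mem (reflectionOf_mem x hx) (mul_mem (reflectionOf_mem a ha) hg))
      (by omega) u hu
    exact (Subgroup.mul_mem_cancel_left _ (hH a ha)).1
      ((Subgroup.mul_mem_cancel_left _ (hH x hx)).1 this)

/-- An isometry `g` with `g - 1` of rank one is a reflection. -/
theorem exists_eq_reflectionOf
    (hQ : (polarBilin Q).Nondegenerate) {g : V ≃ₗ[F] V} (hg : g ∈ orthogonalGroup Q)
    (h : Module.finrank F (LinearMap.range ((g : Module.End F V) - 1)) = 1) :
    ∃ a ha, g = reflectionOf Q a ha := by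
  obtain ⟨a, ha0, hspan⟩ := finrank_eq_one_iff'.1 h
  obtain ⟨v₀, hv₀⟩ := a.2
  change g v₀ - v₀ = a at hv₀
  have ha : (a : V) ≠ 0 := fun h => ha0 (Subtype.ext h)
  -- `g v = v + c a` and `Q (g v) = Q v` give a relation between `c` and `B(v, a)`
  have key : ∀ v, ∃ c : F, g v = v + c • (a : V) ∧ c * (c * Q (a : V) + polar Q v a) = 0 := by
    intro v
    obtain ⟨c, hc⟩ := hspan ⟨g v - v, ⟨v, rfl⟩⟩
    have hc' : g v = v + c • (a : V) := by
      rw [add_comm]; exact eq_add_of_sub_eq (congrArg Subtype.val hc).symm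
    refine ⟨c, hc', ?_⟩
    have h1 : Q (v - (-c) • (a : V)) = Q v := by
      rw [← hg v, hc', neg_smul, sub_neg_eq_add]
    rw [map_sub_smul] at h1
    linear_combination h1
  by_cases hsing : Q (a : V) = 0
  · -- then `a` is orthogonal to every vector moved by `g`, and these span
    exfalso
    have hmov : ∀ v, g v ≠ v → polar Q v a = 0 := by
      intro v hv
      obtain ⟨c, hc, h1⟩ := key v
      have hc0 : c ≠ 0 := by rintro rfl; exact hv (by simpa using hc)
      simpa [hsing, hc0] using h1
    have hv₀' : g v₀ ≠ v₀ := fun h => ha (by rw [← hv₀, h, sub_self])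
    obtain ⟨u, hu⟩ := exists_polar_ne_zero hQ ha
    by_cases hgu : g u = u
    · have := hmov (v₀ + u) (by
        rw [map_add, hgu]; exact fun h => hv₀' (add_right_cancel h))
      rw [polar_add_left, hmov v₀ hv₀', zero_add] at this
      exact hu this
    · exact hu (hmov u hgu)
  · refine ⟨a, hsing, LinearEquiv.ext fun v => ?_⟩
    rw [reflectionOf_apply]
    by_cases hv : g v = v
    · have := polar_sub_eq_zero hg v₀ hv
      rw [hv₀, polar_comm] at this
      rw [this, zero_div, zero_smul, sub_zero, hv]
    · obtain ⟨c, hc, h1⟩ := key v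
      have hc0 : c ≠ 0 := by rintro rfl; exact hv (by simpa using hc)
      have h2 := (mul_eq_zero.1 h1).resolve_left hc0
      have h3 : polar Q v a / Q (a : V) = -c := by
        field_simp; linear_combination h2
      rw [h3, neg_smul, sub_neg_eq_add, hc]

end QuadraticSpace

/-! ### Totally singular subspaces of a form of minus type -/

section MinusType

variable {F V : Type*} [Field F] [AddCommGroup V] [Module F V] {Q : QuadraticForm F V}

open QuadraticMap

/-- All fibres of a nonzero linear functional have the same size. -/
theorem card_eq_mul_card_fiber (f : V →ₗ[F] F) (hf : f ≠ 0) (c : F) :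
    Nat.card V = Nat.card F * Nat.card {v // f v = c} := by
  obtain ⟨v₀, hv₀⟩ := LinearMap.surjective hf 1
  rw [← Nat.card_prod]
  exact Nat.card_congr
    { toFun := fun v => (f v, ⟨v - (f v - c) • v₀, by simp [hv₀]⟩)
      invFun := fun p => p.2.1 + (p.1 - c) • v₀
      left_inv := fun v => by simp
      right_inv := by
        rintro ⟨a, v, hv⟩
        simp [hv₀, hv] }

/-- The number of zeros of a quadratic form with a totally singular subspace `S` equal to its own
orthogonal: on a coset `v + S` other than `S` the form is affine and not constant. -/
theorem card_zeros_mul_card [Finite F] [Finite V] (S : Submodule F V) (hS : ∀ s ∈ S, Q s = 0)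
    (hS' : ∀ v ∉ S, ∃ s ∈ S, polar Q v s ≠ 0) :
    Nat.card F * Nat.card {v // Q v = 0} + Nat.card S = Nat.card F * Nat.card S + Nat.card V := by
  classical
  have := Fintype.ofFinite V
  have hpos : 0 < Nat.card S := Nat.card_pos
  -- count the pairs `(v, s)` with `Q (v + s) = 0` in two ways
  let N : V → ℕ := fun v => Nat.card {s : S // Q (v + s) = 0}
  have hmem : ∀ v ∈ S, N v = Nat.card S := fun v hv => by
    refine Nat.card_congr (Equiv.subtypeUnivEquiv fun s => hS _ (add_mem hv s.2))
  have hnot : ∀ v ∉ S, Nat.card F * N v = Nat.card S := fun v hv => by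
    obtain ⟨s, hs, hvs⟩ := hS' v hv
    rw [card_eq_mul_card_fiber ((polarBilin Q v).domRestrict S)
      (fun h => hvs (by simpa using LinearMap.congr_fun h ⟨s, hs⟩)) (-Q v)]
    congr 1
    refine Nat.card_congr (Equiv.subtypeEquivRight fun s => ?_)
    rw [QuadraticMap.map_add (f := Q), hS _ s.2, add_zero, LinearMap.domRestrict_apply,
      polarBilin_apply_apply, eq_neg_iff_add_eq_zero, add_comm]
  have hsum : ∑ v, N v = Nat.card {v // Q v = 0} * Nat.card S := by
    rw [← Nat.card_sigma, ← Nat.card_prod]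
    exact Nat.card_congr
      { toFun := fun p => (⟨p.1 + p.2.1, p.2.2⟩, p.2.1)
        invFun := fun p => ⟨p.1.1 - p.2, p.2, by simpa using p.1.2⟩
        left_inv := by
          rintro ⟨v, s, h⟩
          simp only [Sigma.mk.injEq, add_sub_cancel_right, true_and]
          congr 1 <;> simp
        right_inv := by
          rintro ⟨⟨v, h⟩, s⟩
          simp }
  have hsum2 : ∑ v, (Nat.card F * N v + if v ∈ S then Nat.card S else 0) =
      ∑ v, ((if v ∈ S then Nat.card F * Nat.card S else 0) + Nat.card S) := by
    refine Finset.sum_congr rfl fun v _ => ?_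
    by_cases hv : v ∈ S
    · simp [hv, hmem]
    · simp [hv, hnot]
  have hcard : (Finset.univ.filter (· ∈ S)).card = Nat.card S := by
    rw [← Fintype.card_subtype, Nat.card_eq_fintype_card]
  rw [Finset.sum_add_distrib, Finset.sum_add_distrib, ← Finset.mul_sum, hsum,
    ← Finset.sum_filter, ← Finset.sum_filter, Finset.sum_const, Finset.sum_const, hcard,
    Finset.sum_const, Finset.card_univ, ← Nat.card_eq_fintype_card] at hsum2
  simp only [smul_eq_mul] at hsum2
  refine Nat.eq_of_mul_eq_mul_right hpos ?_
  linarith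

/-- A quadratic space of minus type and dimension `2m` has no totally singular subspace of dimension
`m`: with one it would have more isotropic vectors. -/
theorem IsMinusType.two_mul_finrank_lt [Finite F] {m : ℕ} (hm : m ≠ 0) (hQ : IsMinusType m Q)
    (S : Submodule F V) (hS : ∀ s ∈ S, Q s = 0) :
    2 * Module.finrank F S < Module.finrank F V := by
  by_contra! hlt
  have hV := hQ.finrank_eq
  have : Module.Finite F V := Module.finite_of_finrank_pos (by omega)
  have : Finite V := Module.finite_of_finite F
  have hle : S ≤ LinearMap.BilinForm.orthogonal (polarBilin Q) S := by
    intro s hs s' hs'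
    change polar Q s' s = 0
    rw [polar, hS _ (add_mem hs' hs), hS _ hs, hS _ hs']
    simp
  -- comparing dimensions, `S` is its own orthogonal
  have hfr := LinearMap.BilinForm.finrank_orthogonal hQ.nondegenerate S
  have hle' := Submodule.finrank_mono hle
  have heq := Submodule.eq_of_le_of_finrank_le hle (by omega)
  have hSm : Module.finrank F S = m := by omega
  have hcount := card_zeros_mul_card S hS (by
    intro v hv
    rw [heq] at hv
    by_contra! h
    exact hv fun s hs => (polar_comm Q s v).trans (h s hs))
  have hZ : Nat.card {v // Q v = 0} =
      (Nat.card F ^ (m - 1) - 1) * (Nat.card F ^ m + 1) + 1 := by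
    rw [← hQ.card_isotropic]
    have : {v : V | Q v = 0} = insert 0 {v | v ≠ 0 ∧ Q v = 0} := by
      ext v
      by_cases hv : v = 0 <;> simp [hv]
    change Nat.card {v : V | Q v = 0} = _
    rw [Nat.card_coe_set_eq, this, Set.ncard_insert_of_notMem (by simp)]
  rw [hZ, Module.natCard_eq_pow_finrank (K := F) (V := S),
    Module.natCard_eq_pow_finrank (K := F) (V := V), hSm, hV] at hcount
  obtain ⟨n, rfl⟩ : ∃ n, m = n + 1 := ⟨m - 1, by omega⟩
  have hq : 1 < Nat.card F := Finite.one_lt_card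
  obtain ⟨r, hr⟩ : ∃ r, Nat.card F ^ n = r + 1 :=
    Nat.exists_eq_add_one_of_ne_zero (pow_ne_zero n (by omega))
  have h1 : Nat.card F ^ (n + 1) = (r + 1) * Nat.card F := by rw [pow_succ, hr]
  have h2 : Nat.card F ^ (2 * (n + 1)) = ((r + 1) * Nat.card F) ^ 2 := by
    rw [mul_comm, pow_mul, h1]
  rw [h1, h2, Nat.add_sub_cancel, hr, Nat.add_sub_cancel] at hcount
  generalize Nat.card F = q at hcount hq
  nlinarith [mul_pos (Nat.zero_lt_of_lt hq) (Nat.succ_pos r)]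

end MinusType

/-! ### Coefficients of self-reciprocal polynomials -/

section Coefficients

theorem sum_range_two_mul_add_one {A : Type*} [AddCommMonoid A] (m : ℕ) (h : ℕ → A) :
    ∑ i ∈ Finset.range (2 * m + 1), h i =
      (∑ i ∈ Finset.range m, (h i + h (2 * m - i))) + h m := by
  have e : 2 * m + 1 = m + (m + 1) := by omega
  rw [e, Finset.sum_range_add, Finset.sum_range_succ', Finset.sum_add_distrib, add_zero,
    ← add_assoc, ← Finset.sum_range_reflect (fun i => h (2 * m - i))]
  congr 2
  refine Finset.sum_congr rfl fun i hi => ?_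
  rw [Finset.mem_range] at hi
  congr 1
  omega

variable {F : Type*} [Field F] {m : ℕ} {M : F[X]}

theorem coeff_zero_mul_coeff_of_isSelfReciprocal (hM : M.natDegree = 2 * m)
    (hrec : IsSelfReciprocal M) {i : ℕ} (hi : i ≤ 2 * m) :
    M.coeff 0 * M.coeff i = M.coeff (2 * m - i) := by
  have h0 : M.coeff 0 ≠ 0 := by simpa [coeff_zero_eq_eval_zero] using hrec.1
  have h := congrArg (fun p => p.coeff i) hrec.2
  simp only [reciprocal, coeff_C_mul, coeff_reverse, hM, revAt_le hi,
    ← coeff_zero_eq_eval_zero] at h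
  rw [h]
  field_simp

theorem coeff_zero_eq_one [CharP F 2] (hmonic : M.Monic) (hM : M.natDegree = 2 * m)
    (hrec : IsSelfReciprocal M) : M.coeff 0 = 1 := by
  have h := coeff_zero_mul_coeff_of_isSelfReciprocal hM hrec (Nat.zero_le _)
  rw [Nat.sub_zero, ← hM, hmonic.coeff_natDegree] at h
  have h2 : (M.coeff 0 + 1) * (M.coeff 0 + 1) = 0 := by
    have := CharTwo.two_eq_zero (R := F)
    linear_combination h + (M.coeff 0 + 1) * this
  exact CharTwo.add_eq_zero.1 (mul_self_eq_zero.1 h2)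

theorem coeff_eq_coeff_sub [CharP F 2] (hmonic : M.Monic) (hM : M.natDegree = 2 * m)
    (hrec : IsSelfReciprocal M) {i : ℕ} (hi : i ≤ 2 * m) : M.coeff i = M.coeff (2 * m - i) := by
  rw [← coeff_zero_mul_coeff_of_isSelfReciprocal hM hrec hi, coeff_zero_eq_one hmonic hM hrec,
    one_mul]

/-- The outer coefficients cancel in pairs in `M(1) = 0`. -/
theorem coeff_middle_eq_zero [CharP F 2] (hM : M.natDegree = 2 * m)
    (hsymm : ∀ i ≤ 2 * m, M.coeff i = M.coeff (2 * m - i)) (hone : M.eval 1 = 0) :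
    M.coeff m = 0 := by
  rw [eval_eq_sum_range, hM, sum_range_two_mul_add_one, Finset.sum_eq_zero, zero_add] at hone
  · simpa using hone
  · intro i hi
    rw [Finset.mem_range] at hi
    rw [← hsymm i (by omega)]
    simpa using CharTwo.add_self_eq_zero (M.coeff i)

end Coefficients

/-! ### The quadratic form -/

section Form

/-- The `F`-linear map `u ↦ u ^ (q ^ k)`, where `q = |F|`. -/
noncomputable def frobPow (F E : Type*) [Field F] [Finite F] [Field E] [Algebra F E] (k : ℕ) :
    E →ₗ[F] E where
  toFun u := u ^ (Nat.card F ^ k)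
  map_add' := pow_card_pow_add k
  map_smul' := pow_card_pow_smul k

theorem frobPow_apply {F E : Type*} [Field F] [Finite F] [Field E] [Algebra F E] (k : ℕ) (u : E) :
    frobPow F E k u = u ^ (Nat.card F ^ k) := rfl

theorem frobPow_one_frobPow {F E : Type*} [Field F] [Finite F] [Field E] [Algebra F E] (k : ℕ)
    (u : E) : frobPow F E 1 (frobPow F E k u) = frobPow F E (k + 1) u := by
  simp only [frobPow_apply, ← pow_mul, ← pow_add]

theorem frobPow_one_mul {F E : Type*} [Field F] [Finite F] [Field E] [Algebra F E] (u v : E) :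
    frobPow F E 1 (u * v) = frobPow F E 1 u * frobPow F E 1 v := by
  simp only [frobPow_apply, mul_pow]

/-- An element of an extension of `F` fixed by the `|F|`-power map lies in `F`. -/
theorem exists_algebraMap_eq_of_pow_card {F E : Type*} [Field F] [Finite F] [Field E] [Algebra F E]
    {x : E} (hx : x ^ Nat.card F = x) : ∃ a : F, algebraMap F E a = x := by
  classical
  have := Fintype.ofFinite F
  rw [Nat.card_eq_fintype_card] at hx
  have h0 : (X ^ Fintype.card F - X : E[X]) ≠ 0 :=
    FiniteField.X_pow_card_sub_X_ne_zero E Fintype.one_lt_card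
  by_contra! h
  have hsub : insert x (Finset.univ.image (algebraMap F E)) ⊆
      (X ^ Fintype.card F - X : E[X]).roots.toFinset := by
    intro y hy
    rw [Multiset.mem_toFinset, mem_roots h0]
    rcases Finset.mem_insert.1 hy with rfl | hy
    · simp [hx]
    · obtain ⟨a, -, rfl⟩ := Finset.mem_image.1 hy
      simp [← map_pow, FiniteField.pow_card]
  have h1 := (Finset.card_le_card hsub).trans (Multiset.toFinset_card_le _)
  rw [Finset.card_insert_of_notMem (by simpa using h),
    Finset.card_image_of_injective _ (algebraMap F E).injective, Finset.card_univ] at h1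
  have h2 := h1.trans (card_roots' _)
  rw [FiniteField.X_pow_card_sub_X_natDegree_eq E Fintype.one_lt_card] at h2
  omega

/-- The part of the quadratic form `Q` that does not involve `t`:
`∑ cᵢ x^(q^k + q^(k+m-i))` over `i ≤ k < m`, for `M = ∑ cᵢ x^i`. -/
noncomputable def formPoly {F : Type*} [Field F] (m : ℕ) (M : F[X]) : F[X] :=
  ∑ i ∈ Finset.range m, ∑ k ∈ Finset.Ico i m,
    C (M.coeff i) * X ^ (Nat.card F ^ k + Nat.card F ^ (k + m - i))

theorem aeval_qAssociate {F E : Type*} [Field F] [CommRing E] [Algebra F E] (M : F[X]) (u : E) :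
     aeval u (qAssociate (Nat.card F) M) =
    ∑ i ∈ Finset.range (M.natDegree + 1), M.coeff i • u ^ (Nat.card F ^ i) := by
  simp [qAssociate, map_sum, aeval_monomial, Algebra.smul_def]

variable {F E : Type*} [Field F] [Finite F] [Field E] [Algebra (RatFunc F) E]
    [Algebra F E] [IsScalarTower F (RatFunc F) E] {m : ℕ} {M : F[X]}

variable (E) in
/-- The quadratic map `u ↦ t u^(q^(m-1) + q^m) + ∑ cᵢ u^(q^k + q^(k+m-i))` on `E`, where the sum is
over `i ≤ k < m`. Its restriction to the roots of `L` takes values in `F`. -/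
noncomputable def formE (m : ℕ) (M : F[X]) : QuadraticMap F E E :=
  algebraMap (RatFunc F) E RatFunc.X •
      QuadraticMap.linMulLin (frobPow F E (m - 1)) (frobPow F E m) +
    ∑ i ∈ Finset.range m, ∑ k ∈ Finset.Ico i m,
      M.coeff i • QuadraticMap.linMulLin (frobPow F E k) (frobPow F E (k + m - i))

theorem formE_apply (u : E) : formE E m M u =
    algebraMap (RatFunc F) E RatFunc.X * (frobPow F E (m - 1) u * frobPow F E m u) +
    ∑ i ∈ Finset.range m, ∑ k ∈ Finset.Ico i m,
      M.coeff i • (frobPow F E k u * frobPow F E (k + m - i) u) := by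
  simp [formE, ← Algebra.smul_def]

theorem formE_eq_aeval (u : E) : formE E m M u =
    algebraMap (RatFunc F) E RatFunc.X * u ^ (Nat.card F ^ (m - 1) + Nat.card F ^ m) +
      aeval u (formPoly m M) := by
  rw [formE_apply, formPoly]
  simp only [map_sum, map_mul, map_pow, aeval_X, aeval_C, frobPow_apply, pow_add,
    Algebra.smul_def]

theorem aeval_polyL (u : E) : aeval u (polyL m M) =
    ∑ i ∈ Finset.range (M.natDegree + 1), M.coeff i • frobPow F E i u +
      algebraMap (RatFunc F) E RatFunc.X ^ Nat.card F * frobPow F E (m + 1) u +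
      algebraMap (RatFunc F) E RatFunc.X * frobPow F E (m - 1) u := by
  simp only [polyL, map_add, map_mul, map_pow, aeval_X, aeval_C, aeval_map_algebraMap,
    aeval_qAssociate, frobPow_apply]

/-- The operator `τ^(-m) L` is self-adjoint with zero middle coefficient, so `u · τ^(-m) L u` is
of the form `(τ - 1) Q(u)`, where `τ` is the `q`-power map. -/
theorem formE_pow_card_sub [CharP F 2] (hm : 1 ≤ m) (hM : M.natDegree = 2 * m)
    (hsymm : ∀ i ≤ 2 * m, M.coeff i = M.coeff (2 * m - i)) (hmid : M.coeff m = 0) (u : E) :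
    formE E m M u ^ Nat.card F - formE E m M u =
      u ^ (Nat.card F ^ m) * aeval u (polyL m M) := by
  have : CharP E 2 := charP_of_injective_algebraMap (algebraMap F E).injective 2
  have hpow : ∀ x : E, x ^ Nat.card F = frobPow F E 1 x := fun x => by simp [frobPow_apply]
  have hsum : ∑ i ∈ Finset.range (M.natDegree + 1), M.coeff i • frobPow F E i u =
      ∑ i ∈ Finset.range m, M.coeff i • (frobPow F E i u + frobPow F E (2 * m - i) u) := by
    rw [hM, sum_range_two_mul_add_one, hmid, zero_smul, add_zero]
    refine Finset.sum_congr rfl fun i hi => ?_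
    rw [Finset.mem_range] at hi
    rw [← hsymm i (by omega), smul_add]
  -- the terms `τ^k (cᵢ u τ^(m-i) u)` with `i ≤ k < m` telescope
  have htel : ∀ i ∈ Finset.range m,
      (∑ k ∈ Finset.Ico i m,
        M.coeff i • (frobPow F E (k + 1) u * frobPow F E (k + m - i + 1) u)) -
      ∑ k ∈ Finset.Ico i m, M.coeff i • (frobPow F E k u * frobPow F E (k + m - i) u) =
      frobPow F E m u * M.coeff i • (frobPow F E i u + frobPow F E (2 * m - i) u) := by
    intro i hi
    rw [Finset.mem_range] at hi
    rw [← Finset.smul_sum, ← Finset.smul_sum, ← smul_sub, ← Finset.sum_sub_distrib,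
      mul_smul_comm]
    congr 1
    have h1 := Finset.sum_Ico_sub (fun k => frobPow F E k u * frobPow F E (k + m - i) u) hi.le
    rw [show m + m - i = 2 * m - i by omega, show i + m - i = m by omega,
      CharTwo.sub_eq_add] at h1
    rw [mul_add, add_comm (frobPow F E m u * _), mul_comm (frobPow F E m u) (frobPow F E i u), ← h1]
    refine Finset.sum_congr rfl fun k hk => ?_
    rw [Finset.mem_Ico] at hk
    rw [show k + m - i + 1 = k + 1 + m - i by omega]
  rw [aeval_polyL, hsum, hpow, formE_apply, map_add, frobPow_one_mul, frobPow_one_mul, map_sum]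
  simp only [map_sum, map_smul, frobPow_one_mul, frobPow_one_frobPow, Nat.sub_add_cancel hm]
  rw [← hpow, ← frobPow_apply, mul_add, mul_add, Finset.mul_sum, ← Finset.sum_congr rfl htel,
    Finset.sum_sub_distrib, CharTwo.sub_eq_add, CharTwo.sub_eq_add]
  ring

end Form

/-- A monic palindromic polynomial of degree `2m` with vanishing middle coefficient. -/
structure IsPalindrome {F : Type*} [Field F] (m : ℕ) (M : F[X]) : Prop where
  monic : M.Monic
  natDegree_eq : M.natDegree = 2 * m
  coeff_symm : ∀ i ≤ 2 * m, M.coeff i = M.coeff (2 * m - i)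
  coeff_middle : M.coeff m = 0

theorem IsPalindrome.coeff_zero {F : Type*} [Field F] {m : ℕ} {M : F[X]} (hM : IsPalindrome m M) :
    M.coeff 0 = 1 := by
  rw [hM.coeff_symm 0 (Nat.zero_le _), Nat.sub_zero, ← hM.natDegree_eq, hM.monic.coeff_natDegree]

/-! ### Degrees and coefficients of the polynomials involved -/

section PolyL

theorem coeff_qAssociate {F : Type*} [Semiring F] {q : ℕ} (hq : 1 < q) (M : F[X]) (i : ℕ) :
    (qAssociate q M).coeff (q ^ i) = M.coeff i := by
  simp only [qAssociate, finsetSum_coeff, coeff_monomial, (Nat.pow_right_injective hq).eq_iff]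
  rw [Finset.sum_ite_eq']
  split_ifs with h
  · rfl
  · rw [Finset.mem_range, not_lt] at h
    rw [coeff_eq_zero_of_natDegree_lt (by omega)]

theorem natDegree_qAssociate_le {F : Type*} [Semiring F] {q : ℕ} (hq : 1 < q) (M : F[X]) :
    (qAssociate q M).natDegree ≤ q ^ M.natDegree := by
  refine natDegree_sum_le_of_forall_le _ _ fun i hi => (natDegree_monomial_le _).trans ?_
  exact Nat.pow_le_pow_right hq.le (Nat.lt_succ_iff.1 (Finset.mem_range.1 hi))

variable {F : Type*} [Field F] [Finite F] {m : ℕ} {M : F[X]}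

theorem natDegree_polyL_le (hm : 2 ≤ m) (hM : IsPalindrome m M) :
    (polyL m M).natDegree ≤ Nat.card F ^ (2 * m) := by
  have hq : 1 < Nat.card F := Finite.one_lt_card
  refine natDegree_add_le_of_degree_le (natDegree_add_le_of_degree_le ?_ ?_) ?_
  · rw [natDegree_map, ← hM.natDegree_eq]
    exact natDegree_qAssociate_le hq M
  · exact (natDegree_C_mul_X_pow_le _ _).trans (Nat.pow_le_pow_right hq.le (by omega))
  · exact (natDegree_C_mul_X_pow_le _ _).trans (Nat.pow_le_pow_right hq.le (by omega))

theorem coeff_polyL (hm : 2 ≤ m) (hM : IsPalindrome m M) :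
    (polyL m M).coeff (Nat.card F ^ (2 * m)) = 1 := by
  have hq : 1 < Nat.card F := Finite.one_lt_card
  simp only [polyL, coeff_add, coeff_map, coeff_C_mul_X_pow, coeff_qAssociate hq,
    (Nat.pow_right_injective hq).eq_iff]
  rw [if_neg (by omega), if_neg (by omega), ← hM.natDegree_eq, hM.monic.coeff_natDegree]
  simp

theorem natDegree_polyL (hm : 2 ≤ m) (hM : IsPalindrome m M) :
    (polyL m M).natDegree = Nat.card F ^ (2 * m) :=
  natDegree_eq_of_le_of_coeff_ne_zero (natDegree_polyL_le hm hM)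
    (by rw [coeff_polyL hm hM]; exact one_ne_zero)

theorem monic_polyL (hm : 2 ≤ m) (hM : IsPalindrome m M) : (polyL m M).Monic :=
  monic_of_natDegree_le_of_coeff_eq_one _ (natDegree_polyL_le hm hM) (coeff_polyL hm hM)

theorem natCast_card_eq_zero (F A : Type*) [Field F] [Finite F] [Semiring A] [Algebra F A] :
    (Nat.card F : A) = 0 := by
  have := Fintype.ofFinite F
  rw [Nat.card_eq_fintype_card, ← map_natCast (algebraMap F A), FiniteField.cast_card_eq_zero,
    map_zero]

theorem derivative_polyL (hm : 2 ≤ m) (hM : IsPalindrome m M) :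
    derivative (polyL m M) = 1 := by
  have h1 : ∀ (j : ℕ) (a : RatFunc F), j ≠ 0 →
      derivative (C a * X ^ (Nat.card F ^ j)) = 0 := fun j a hj => by
    rw [derivative_C_mul_X_pow, Nat.cast_pow, natCast_card_eq_zero F (RatFunc F), zero_pow hj,
      mul_zero, map_zero, zero_mul]
  rw [polyL, derivative_add, derivative_add, h1 _ _ (by omega), h1 _ _ (by omega), add_zero,
    add_zero, derivative_map, qAssociate, derivative_sum, Finset.sum_range_succ']
  rw [Finset.sum_eq_zero, pow_zero, zero_add, hM.coeff_zero]
  · simp [derivative_monomial]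
  · intro i _
    rw [derivative_monomial, Nat.cast_pow, natCast_card_eq_zero F F, zero_pow (by omega), mul_zero,
      monomial_zero_right]

theorem separable_polyL (hm : 2 ≤ m) (hM : IsPalindrome m M) : (polyL m M).Separable := by
  rw [Separable, derivative_polyL hm hM]
  exact isCoprime_one_right

theorem natDegree_formPoly_le (hm : 2 ≤ m) (M : F[X]) :
    (formPoly m M).natDegree ≤ Nat.card F ^ (m - 1) + Nat.card F ^ (2 * m - 1) := by
  have hq : 1 < Nat.card F := Finite.one_lt_card
  refine natDegree_sum_le_of_forall_le _ _ fun i hi => natDegree_sum_le_of_forall_le _ _ fun k hk =>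
    (natDegree_C_mul_X_pow_le _ _).trans ?_
  rw [Finset.mem_Ico] at hk
  exact add_le_add (Nat.pow_le_pow_right hq.le (by omega)) (Nat.pow_le_pow_right hq.le (by omega))

theorem coeff_formPoly (hm : 2 ≤ m) (hM : IsPalindrome m M) :
    (formPoly m M).coeff (Nat.card F ^ (m - 1) + Nat.card F ^ (2 * m - 1)) = 1 := by
  have hq : 1 < Nat.card F := Finite.one_lt_card
  have hlt : ∀ i k, k < m → k + m - i < 2 * m - 1 →
      Nat.card F ^ (m - 1) + Nat.card F ^ (2 * m - 1) ≠ Nat.card F ^ k + Nat.card F ^ (k + m - i) :=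
    fun i k hk hi => ne_of_gt (add_lt_add_of_le_of_lt (Nat.pow_le_pow_right hq.le (by omega))
      (Nat.pow_lt_pow_right hq hi))
  simp only [formPoly, finsetSum_coeff, coeff_C_mul_X_pow]
  rw [Finset.sum_eq_single 0, Finset.sum_eq_single (m - 1), if_pos, hM.coeff_zero]
  · rw [show m - 1 + m - 0 = 2 * m - 1 by omega]
  · intro k hk hk'
    rw [Finset.mem_Ico] at hk
    exact if_neg (hlt _ _ (by omega) (by omega))
  · exact fun h => absurd (Finset.mem_Ico.2 ⟨by omega, by omega⟩) h
  · intro i hi hi'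
    rw [Finset.mem_range] at hi
    refine Finset.sum_eq_zero fun k hk => ?_
    rw [Finset.mem_Ico] at hk
    exact if_neg (hlt _ _ (by omega) (by omega))
  · exact fun h => absurd (Finset.mem_range.2 (by omega)) h

theorem X_pow_dvd_formPoly (m : ℕ) (M : F[X]) : X ^ (1 + Nat.card F ^ m) ∣ formPoly m M := by
  have hq : 1 < Nat.card F := Finite.one_lt_card
  refine Finset.dvd_sum fun i hi => Finset.dvd_sum fun k hk => Dvd.dvd.mul_left (pow_dvd_pow _ ?_) _
  rw [Finset.mem_Ico] at hk
  exact add_le_add (Nat.one_le_pow _ _ (by omega)) (Nat.pow_le_pow_right hq.le (by omega))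

end PolyL

/-! ### The quadratic space of roots of `L` -/

/-- A quadratic map into an extension ring all of whose values lie in `F` comes from a quadratic
form over `F`. -/
theorem exists_quadraticForm {F W E : Type*} [Field F] [AddCommGroup W] [Module F W] [Field E]
    [Algebra F E] (q : QuadraticMap F W E) (hq : ∀ w, ∃ a, algebraMap F E a = q w) :
    ∃ Q : QuadraticForm F W, ∀ w, algebraMap F E (Q w) = q w := by
  choose f hf using hq
  have inj := (algebraMap F E).injective
  have hpol : ∀ x y, algebraMap F E (QuadraticMap.polar f x y) = QuadraticMap.polar q x y :=
    fun x y => by simp only [QuadraticMap.polar, map_sub, hf]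
  refine ⟨QuadraticMap.ofPolar f (fun a x => inj ?_) (fun x x' y => inj ?_)
    (fun a x y => inj ?_), hf⟩
  · rw [hf, smul_eq_mul, map_mul, hf, QuadraticMap.map_smul, Algebra.smul_def]
  · rw [map_add, hpol, hpol, hpol, QuadraticMap.polar_add_left]
  · rw [smul_eq_mul, map_mul, hpol, hpol, QuadraticMap.polar_smul_left, Algebra.smul_def]

theorem ncard_le_natDegree {F E : Type*} [Field F] [Field E] [Algebra F E] {V : Submodule F E}
    (s : Set V) (p : E[X]) (hp : p ≠ 0)
    (hs : ∀ v ∈ s, p.eval (v : E) = 0) : s.ncard ≤ p.natDegree := by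
  classical
  have h : (Subtype.val '' s : Set E) ⊆ (p.roots.toFinset : Set E) := by
    rintro _ ⟨v, hv, rfl⟩
    simpa [hp] using hs v hv
  rw [← Set.ncard_image_of_injective s Subtype.val_injective]
  refine (Set.ncard_le_ncard h (Finset.finite_toSet _)).trans ?_
  rw [Set.ncard_coe_finset]
  exact (Multiset.toFinset_card_le _).trans (card_roots' p)

section RootSpace

variable {F E : Type*} [Field F] [Finite F] [Field E] [Algebra (RatFunc F) E]
    [Algebra F E] {m : ℕ} {M : F[X]}

/-- The space `V` of roots of `L` in `E`. -/
noncomputable abbrev rootSpaceL (F E : Type*) [Field F] [Finite F] [Field E] [Algebra (RatFunc F) E]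
    [Algebra F E] (m : ℕ) (M : F[X]) : Submodule F E :=
  rootSpace F E (polyL m M) (isQPolynomial_polyL m M)

theorem mem_rootSpaceL {u : E} : u ∈ rootSpaceL F E m M ↔ aeval u (polyL m M) = 0 := Iff.rfl

theorem card_rootSpaceL [IsSplittingField (RatFunc F) E (polyL m M)] (hm : 2 ≤ m)
    (hM : IsPalindrome m M) : Nat.card (rootSpaceL F E m M) = Nat.card F ^ (2 * m) := by
  rw [← natDegree_polyL hm hM, ← card_rootSet_eq_natDegree (separable_polyL hm hM)
    (IsSplittingField.splits E (polyL m M)), ← Nat.card_eq_fintype_card]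
  refine Nat.card_congr (Equiv.subtypeEquivRight fun u => ?_)
  rw [mem_rootSet, mem_rootSpaceL]
  exact (and_iff_right (monic_polyL hm hM).ne_zero).symm

theorem finite_rootSpaceL [IsSplittingField (RatFunc F) E (polyL m M)] (hm : 2 ≤ m)
    (hM : IsPalindrome m M) : Finite (rootSpaceL F E m M) :=
  Nat.finite_of_card_ne_zero (by
    rw [card_rootSpaceL hm hM]
    exact pow_ne_zero _ Nat.card_pos.ne')

theorem finrank_rootSpaceL [IsSplittingField (RatFunc F) E (polyL m M)] (hm : 2 ≤ m)
    (hM : IsPalindrome m M) : Module.finrank F (rootSpaceL F E m M) = 2 * m := by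
  have := finite_rootSpaceL (E := E) hm hM
  have h := card_rootSpaceL (E := E) hm hM
  rw [Module.natCard_eq_pow_finrank (K := F)] at h
  exact Nat.pow_right_injective Finite.one_lt_card h

/-- The polynomial over `E` whose roots are the solutions of `formE u = a`. -/
noncomputable def levelPoly (m : ℕ) (M : F[X]) (a : E) : E[X] :=
  C (algebraMap (RatFunc F) E RatFunc.X) * X ^ (Nat.card F ^ (m - 1) + Nat.card F ^ m) +
    (formPoly m M).map (algebraMap F E) - C a

theorem natDegree_levelPoly_le (hm : 2 ≤ m) (M : F[X]) (a : E) :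
    (levelPoly m M a).natDegree ≤ Nat.card F ^ (m - 1) + Nat.card F ^ (2 * m - 1) := by
  have hq : 1 < Nat.card F := Finite.one_lt_card
  rw [levelPoly, natDegree_sub_C]
  refine natDegree_add_le_of_degree_le ?_ ?_
  · exact (natDegree_C_mul_X_pow_le _ _).trans
      (add_le_add le_rfl (Nat.pow_le_pow_right hq.le (by omega)))
  · rw [natDegree_map]
    exact natDegree_formPoly_le hm M

theorem levelPoly_ne_zero (hm : 2 ≤ m) (hM : IsPalindrome m M) (a : E) :
    levelPoly m M a ≠ 0 := by
  have hq : 1 < Nat.card F := Finite.one_lt_card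
  intro h
  have h1 := congrArg (fun p => p.coeff (Nat.card F ^ (m - 1) + Nat.card F ^ (2 * m - 1))) h
  have h2 : Nat.card F ^ m < Nat.card F ^ (2 * m - 1) := Nat.pow_lt_pow_right hq (by omega)
  simp only [levelPoly, coeff_sub, coeff_add, coeff_C_mul_X_pow, coeff_map, coeff_formPoly hm hM,
    coeff_C, coeff_zero, map_one] at h1
  rw [if_neg (by omega), if_neg (by omega)] at h1
  simp at h1

/-- For fixed `w`, the polynomial in `u` giving the polarization of `formE` at `(u, w)`. -/
noncomputable def polarPoly (m : ℕ) (M : F[X]) (w : E) : E[X] :=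
  C (algebraMap (RatFunc F) E RatFunc.X) *
      (C (frobPow F E m w) * X ^ (Nat.card F ^ (m - 1)) +
        C (frobPow F E (m - 1) w) * X ^ (Nat.card F ^ m)) +
    ∑ i ∈ Finset.range m, ∑ k ∈ Finset.Ico i m, C (algebraMap F E (M.coeff i)) *
      (C (frobPow F E (k + m - i) w) * X ^ (Nat.card F ^ k) +
        C (frobPow F E k w) * X ^ (Nat.card F ^ (k + m - i)))

theorem natDegree_polarPoly_le (hm : 2 ≤ m) (M : F[X]) (w : E) :
    (polarPoly m M w).natDegree ≤ Nat.card F ^ (2 * m - 1) := by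
  have hq : 1 < Nat.card F := Finite.one_lt_card
  have key : ∀ j, j ≤ 2 * m - 1 → ∀ a : E,
      (C a * X ^ (Nat.card F ^ j)).natDegree ≤ Nat.card F ^ (2 * m - 1) := fun j hj a =>
    (natDegree_C_mul_X_pow_le _ _).trans (Nat.pow_le_pow_right hq.le hj)
  refine natDegree_add_le_of_degree_le ?_ (natDegree_sum_le_of_forall_le _ _ fun i hi =>
    natDegree_sum_le_of_forall_le _ _ fun k hk => ?_)
  · exact (natDegree_C_mul_le _ _).trans
      (natDegree_add_le_of_degree_le (key _ (by omega) _) (key _ (by omega) _))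
  · rw [Finset.mem_Ico] at hk
    exact (natDegree_C_mul_le _ _).trans
      (natDegree_add_le_of_degree_le (key _ (by omega) _) (key _ (by omega) _))

theorem coeff_polarPoly (hm : 2 ≤ m) (hM : IsPalindrome m M) (w : E) :
    (polarPoly m M w).coeff (Nat.card F ^ (2 * m - 1)) = frobPow F E (m - 1) w := by
  have hq : 1 < Nat.card F := Finite.one_lt_card
  simp only [polarPoly, finsetSum_coeff, coeff_add, coeff_C_mul, coeff_X_pow,
    (Nat.pow_right_injective hq).eq_iff]
  rw [if_neg (by omega), if_neg (by omega), Finset.sum_eq_single 0, Finset.sum_eq_single (m - 1),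
    if_neg (by omega), if_pos (by omega), hM.coeff_zero]
  · simp
  · intro k hk hk'
    rw [Finset.mem_Ico] at hk
    rw [if_neg (by omega), if_neg (by omega)]
    simp
  · exact fun h => absurd (Finset.mem_Ico.2 ⟨by omega, by omega⟩) h
  · intro i hi hi'
    rw [Finset.mem_range] at hi
    refine Finset.sum_eq_zero fun k hk => ?_
    rw [Finset.mem_Ico] at hk
    rw [if_neg (by omega), if_neg (by omega)]
    simp
  · exact fun h => absurd (Finset.mem_range.2 (by omega)) h

variable [IsScalarTower F (RatFunc F) E]

theorem exists_algebraMap_eq_formE [CharP F 2] (hm : 2 ≤ m) (hM : IsPalindrome m M) {u : E}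
    (hu : u ∈ rootSpaceL F E m M) : ∃ a : F, algebraMap F E a = formE E m M u := by
  refine exists_algebraMap_eq_of_pow_card (sub_eq_zero.1 ?_)
  rw [formE_pow_card_sub (by omega) hM.natDegree_eq hM.coeff_symm hM.coeff_middle,
    mem_rootSpaceL.1 hu, mul_zero]

/-- The restriction of `formE` to the roots of `L`, as a quadratic form over `F`. -/
theorem exists_formV [CharP F 2] (hm : 2 ≤ m) (hM : IsPalindrome m M) :
    ∃ Q : QuadraticForm F (rootSpaceL F E m M), ∀ v, algebraMap F E (Q v) = formE E m M v :=
  exists_quadraticForm ((formE E m M).comp (rootSpaceL F E m M).subtype) fun v =>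
    exists_algebraMap_eq_formE hm hM v.2

theorem eval_levelPoly (a u : E) : (levelPoly m M a).eval u = formE E m M u - a := by
  simp [levelPoly, formE_eq_aeval, eval_map_algebraMap]

variable {Q : QuadraticForm F (rootSpaceL F E m M)} (hQ : ∀ v, algebraMap F E (Q v) = formE E m M v)

include hQ in
theorem ncard_level_le (hm : 2 ≤ m) (hM : IsPalindrome m M) (a : F) :
    {v | Q v = a}.ncard ≤ Nat.card F ^ (m - 1) + Nat.card F ^ (2 * m - 1) := by
  refine (ncard_le_natDegree _ (levelPoly m M (algebraMap F E a)) (levelPoly_ne_zero hm hM _)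
    fun v hv => ?_).trans (natDegree_levelPoly_le hm M _)
  rw [eval_levelPoly, ← hQ, hv, sub_self]

include hQ in
/-- As a polynomial in `u`, `Q(u)` is divisible by `u^(1 + q^m)`. -/
theorem ncard_isotropic_add_le (hm : 2 ≤ m) (hM : IsPalindrome m M) :
    {v | v ≠ 0 ∧ Q v = 0}.ncard + (1 + Nat.card F ^ m) ≤
      Nat.card F ^ (m - 1) + Nat.card F ^ (2 * m - 1) := by
  have hq : 1 < Nat.card F := Finite.one_lt_card
  have hdvd : X ^ (1 + Nat.card F ^ m) ∣ levelPoly m M (0 : E) := by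
    rw [levelPoly, map_zero, sub_zero]
    refine dvd_add (Dvd.dvd.mul_left (pow_dvd_pow _ ?_) _) ?_
    · exact add_le_add (Nat.one_le_pow _ _ (by omega)) le_rfl
    · simpa using Polynomial.map_dvd (algebraMap F E) (X_pow_dvd_formPoly m M)
  obtain ⟨p, hp⟩ := hdvd
  have h0 := levelPoly_ne_zero (E := E) hm hM 0
  have hp0 : p ≠ 0 := by rintro rfl; exact h0 (by rw [hp, mul_zero])
  have hdeg := natDegree_levelPoly_le hm M (0 : E)
  rw [hp, natDegree_mul (pow_ne_zero _ X_ne_zero) hp0, natDegree_X_pow] at hdeg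
  have := ncard_le_natDegree {v | v ≠ 0 ∧ Q v = 0} p hp0 (by
    rintro v ⟨hv0, hv⟩
    have h1 := eval_levelPoly (m := m) (M := M) (0 : E) v
    rw [← hQ, hv, map_zero, sub_zero, hp, eval_mul, eval_pow, eval_X] at h1
    exact (mul_eq_zero.1 h1).resolve_left (pow_ne_zero _ (by simpa using hv0)))
  omega

include hQ in
/-- The bounds for the numbers of solutions of `Q(v) = a` add up to `|V|`, so they are attained. -/
theorem ncard_isotropic [IsSplittingField (RatFunc F) E (polyL m M)] (hm : 2 ≤ m)
    (hM : IsPalindrome m M) :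
    {v | v ≠ 0 ∧ Q v = 0}.ncard = (Nat.card F ^ (m - 1) - 1) * (Nat.card F ^ m + 1) := by
  classical
  have hq : 1 < Nat.card F := Finite.one_lt_card
  have := finite_rootSpaceL (E := E) hm hM
  have := Fintype.ofFinite (rootSpaceL F E m M)
  have := Fintype.ofFinite F
  have hsum : Nat.card F ^ (2 * m) = ∑ a : F, {v | Q v = a}.ncard := by
    rw [← card_rootSpaceL (E := E) hm hM, Nat.card_eq_fintype_card, ← Finset.card_univ,
      Finset.card_eq_sum_card_fiberwise (f := Q) (t := Finset.univ) (fun _ _ => by simp)]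
    refine Finset.sum_congr rfl fun a _ => ?_
    rw [← Set.ncard_coe_finset]
    congr 1
    ext v
    simp
  have h0 : {v | Q v = 0}.ncard = {v | v ≠ 0 ∧ Q v = 0}.ncard + 1 := by
    have : {v | Q v = 0} = insert 0 {v | v ≠ 0 ∧ Q v = 0} := by
      ext v
      by_cases hv : v = 0 <;> simp [hv]
    rw [this, Set.ncard_insert_of_notMem (by simp)]
  rw [← Finset.add_sum_erase _ _ (Finset.mem_univ (0 : F)), h0] at hsum
  have hle := Finset.sum_le_card_nsmul (Finset.univ.erase (0 : F)) (fun a => {v | Q v = a}.ncard) _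
    fun a _ => ncard_level_le hQ hm hM a
  rw [Finset.card_erase_of_mem (Finset.mem_univ _), Finset.card_univ, ← Nat.card_eq_fintype_card,
    smul_eq_mul] at hle
  have hle0 := ncard_isotropic_add_le hQ hm hM
  obtain ⟨n, rfl⟩ : ∃ n, m = n + 1 := ⟨m - 1, by omega⟩
  obtain ⟨r, hr⟩ : ∃ r, Nat.card F ^ n = r + 1 :=
    Nat.exists_eq_add_one_of_ne_zero (pow_ne_zero n (by omega))
  have h1 : Nat.card F ^ (n + 1) = (r + 1) * Nat.card F := by rw [pow_succ, hr]
  have h2 : Nat.card F ^ (2 * (n + 1) - 1) = (r + 1) * ((r + 1) * Nat.card F) := by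
    rw [show 2 * (n + 1) - 1 = n + (n + 1) by omega, pow_add, h1, hr]
  have h3 : Nat.card F ^ (2 * (n + 1)) = ((r + 1) * Nat.card F) ^ 2 := by
    rw [mul_comm, pow_mul, h1]
  rw [Nat.add_sub_cancel, hr, h2] at hle hle0
  rw [h1] at hle0
  rw [Nat.add_sub_cancel, hr, h1, Nat.add_sub_cancel]
  rw [h3] at hsum
  obtain ⟨s, hs⟩ : ∃ s, Nat.card F = s + 1 := ⟨Nat.card F - 1, by omega⟩
  rw [hs] at hle hle0 hsum ⊢
  rw [Nat.add_sub_cancel] at hle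
  refine le_antisymm ?_ ?_
  · nlinarith
  · nlinarith

theorem eval_polarPoly (u w : E) :
    (polarPoly m M w).eval u = QuadraticMap.polar (formE E m M) u w := by
  simp only [QuadraticMap.polar, formE_apply, polarPoly, map_add, eval_add, eval_mul, eval_C,
    eval_pow, eval_X, eval_finsetSum, Algebra.smul_def, ← frobPow_apply]
  rw [sub_sub, add_add_add_comm, ← Finset.sum_add_distrib, add_sub_add_comm,
    ← Finset.sum_sub_distrib]
  congr 1
  · ring
  · refine Finset.sum_congr rfl fun i _ => ?_
    rw [← Finset.sum_add_distrib, ← Finset.sum_sub_distrib]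
    exact Finset.sum_congr rfl fun k _ => by ring

include hQ in
/-- The polarization is nondegenerate because `B(u, w)` has degree `q^(2m-1) < |V|` in `u`. -/
theorem nondegenerate_polarBilin [IsSplittingField (RatFunc F) E (polyL m M)] (hm : 2 ≤ m)
    (hM : IsPalindrome m M) : (QuadraticMap.polarBilin Q).Nondegenerate := by
  have hq : 1 < Nat.card F := Finite.one_lt_card
  have hpol : ∀ v w : rootSpaceL F E m M, algebraMap F E (QuadraticMap.polar Q v w) =
      QuadraticMap.polar (formE E m M) (v : E) (w : E) := fun v w => by
    simp [QuadraticMap.polar, hQ]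
  have hsep : ∀ w : rootSpaceL F E m M, (∀ v, QuadraticMap.polar Q v w = 0) → w = 0 := by
    intro w hw
    by_contra hw0
    have hc := coeff_polarPoly hm hM (w : E)
    have hp0 : polarPoly m M (w : E) ≠ 0 := by
      intro h
      rw [h, coeff_zero, frobPow_apply] at hc
      exact hw0 (by simpa using eq_zero_of_pow_eq_zero hc.symm)
    have h := ncard_le_natDegree (Set.univ : Set (rootSpaceL F E m M)) _ hp0 fun v _ => by
      rw [eval_polarPoly, ← hpol, hw, map_zero]
    rw [Set.ncard_univ, card_rootSpaceL hm hM] at h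
    exact absurd (h.trans (natDegree_polarPoly_le hm M _))
      (not_le.2 (Nat.pow_lt_pow_right hq (by omega)))
  exact ⟨fun v hv => hsep v fun w => (QuadraticMap.polar_comm Q w v).trans (hv w),
    fun w hw => hsep w hw⟩

include hQ in
theorem isMinusType [IsSplittingField (RatFunc F) E (polyL m M)] (hm : 2 ≤ m)
    (hM : IsPalindrome m M) : IsMinusType m Q :=
  ⟨finrank_rootSpaceL hm hM, nondegenerate_polarBilin hQ hm hM, ncard_isotropic hQ hm hM⟩

end RootSpace

/-! ### The action of the Galois group -/

section Galois

theorem isGalois_of_isSplittingField_polyL {F E : Type*} [Field F] [Finite F] [Field E]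
    [Algebra (RatFunc F) E] {m : ℕ} {M : F[X]} [IsSplittingField (RatFunc F) E (polyL m M)]
    (hm : 2 ≤ m) (hM : IsPalindrome m M) : IsGalois (RatFunc F) E :=
  IsGalois.of_separable_splitting_field (separable_polyL hm hM)

variable {F E : Type*} [Field F] [Finite F] [Field E] [Algebra (RatFunc F) E]
    [Algebra F E] [IsScalarTower F (RatFunc F) E] {m : ℕ} {M : F[X]}

theorem coe_rootRep_apply (σ : E ≃ₐ[RatFunc F] E) (v : rootSpaceL F E m M) :
    (rootRep F E (polyL m M) (isQPolynomial_polyL m M) σ v : E) = σ v := rfl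

variable (F E m M) in
theorem rootRep_injective [IsSplittingField (RatFunc F) E (polyL m M)] :
    Function.Injective (rootRep F E (polyL m M) (isQPolynomial_polyL m M)) := by
  intro σ τ h
  have hadj := IsSplittingField.adjoin_rootSet E (polyL m M)
  have heq : (σ : E →ₐ[RatFunc F] E) = (τ : E →ₐ[RatFunc F] E) := by
    refine AlgHom.ext_of_adjoin_eq_top hadj fun u hu => ?_
    rw [mem_rootSet] at hu
    exact congrArg Subtype.val (LinearEquiv.congr_fun h ⟨u, hu.2⟩)
  exact AlgEquiv.ext fun u => AlgHom.congr_fun heq u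

/-- The polynomial `t u^(q^(m-1) + q^m) + A(u) - 1`, in which `t` occurs linearly. -/
theorem irreducible_levelPoly_one (m : ℕ) (M : F[X]) :
    Irreducible (C RatFunc.X * X ^ (Nat.card F ^ (m - 1) + Nat.card F ^ m) +
      ((formPoly m M).map (algebraMap F (RatFunc F)) - 1) : (RatFunc F)[X]) := by
  have hs : Nat.card F ^ (m - 1) + Nat.card F ^ m ≠ 0 := by
    have := pow_pos (Nat.card_pos (α := F)) m
    omega
  set s := Nat.card F ^ (m - 1) + Nat.card F ^ m with hsdef
  have hX : X ∣ formPoly m M :=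
    (dvd_pow_self X (by omega)).trans (X_pow_dvd_formPoly m M)
  have hcop : IsCoprime (X ^ s : F[X]) (formPoly m M - 1) := by
    refine IsCoprime.pow_left ?_
    obtain ⟨p, hp⟩ := hX
    exact ⟨p, -1, by rw [hp]; ring⟩
  have h1 : Irreducible (C (X ^ s) * X + C (formPoly m M - 1) : F[X][X]) :=
    irreducible_C_mul_X_add_C (pow_ne_zero _ X_ne_zero) hcop.isRelPrime
  -- exchange the roles of `t` and `u`, then pass from `F[t]` to `F(t)` by Gauss's lemma
  have h2 : Bivariate.swap (C (X ^ s) * X + C (formPoly m M - 1) : F[X][X]) =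
      C X * X ^ s + ((formPoly m M).map C - 1) := by
    rw [map_add, map_mul, Bivariate.swap_C, Bivariate.swap_C, Bivariate.swap_Y]
    rw [Polynomial.map_pow, map_X, Polynomial.map_sub, Polynomial.map_one, mul_comm]
  have h3 := (MulEquiv.irreducible_iff (Bivariate.swap (R := F))).2 h1
  rw [h2] at h3
  have hprim : (C X * X ^ s + ((formPoly m M).map C - 1) : F[X][X]).IsPrimitive := by
    refine h3.isPrimitive fun hdeg => h3.not_isUnit ?_
    rw [eq_C_of_natDegree_eq_zero hdeg, coeff_zero_eq_eval_zero]
    obtain ⟨p, hp⟩ := hX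
    simp only [hp, eval_add, eval_mul, eval_pow, eval_X, eval_sub, eval_one, zero_pow hs, mul_zero,
      zero_add, Polynomial.map_mul, map_X, zero_mul, zero_sub]
    exact (isUnit_one.neg).map C
  have h4 := hprim.irreducible_iff_irreducible_map_fraction_map (K := RatFunc F).1 h3
  convert h4 using 1
  simp only [Polynomial.map_add, Polynomial.map_mul, Polynomial.map_pow, map_C, map_X,
    Polynomial.map_sub, Polynomial.map_one, Polynomial.map_map, RatFunc.algebraMap_X]
  congr 3

variable {Q : QuadraticForm F (rootSpaceL F E m M)} (hQ : ∀ v, algebraMap F E (Q v) = formE E m M v)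

include hQ in
/-- The Galois group permutes transitively the vectors with `Q(v) = 1`, since they are roots of one
irreducible polynomial. -/
theorem exists_rootRep_apply_eq [IsSplittingField (RatFunc F) E (polyL m M)]
    (hm : 2 ≤ m) (hM : IsPalindrome m M) (v w : rootSpaceL F E m M) (hv : Q v = 1) (hw : Q w = 1) :
    ∃ σ, rootRep F E (polyL m M) (isQPolynomial_polyL m M) σ v = w := by
  have := isGalois_of_isSplittingField_polyL (E := E) hm hM
  have hirr := irreducible_levelPoly_one m M
  have hroot : ∀ u : rootSpaceL F E m M, Q u = 1 → aeval (u : E)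
      (C RatFunc.X * X ^ (Nat.card F ^ (m - 1) + Nat.card F ^ m) +
      ((formPoly m M).map (algebraMap F (RatFunc F)) - 1) : (RatFunc F)[X]) = 0 := by
    intro u hu
    have h := hQ u
    rw [hu, map_one, formE_eq_aeval] at h
    simp only [map_add, map_mul, map_sub, map_pow, aeval_X, aeval_C, map_one,
      aeval_map_algebraMap]
    linear_combination -h
  have hconj : IsConjRoot (RatFunc F) (w : E) (v : E) := by
    rw [IsConjRoot, ← minpoly.eq_of_irreducible hirr (hroot v hv),
      ← minpoly.eq_of_irreducible hirr (hroot w hw)]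
  obtain ⟨σ, hσ⟩ := isConjRoot_iff_exists_algEquiv.1 hconj
  exact ⟨σ, Subtype.ext hσ⟩

include hQ in
theorem rootRep_mem_orthogonalGroup (σ : E ≃ₐ[RatFunc F] E) :
    rootRep F E (polyL m M) (isQPolynomial_polyL m M) σ ∈ orthogonalGroup Q := by
  intro v
  apply (algebraMap F E).injective
  rw [hQ, coe_rootRep_apply, formE_eq_aeval]
  have h1 : aeval (σ (v : E)) (formPoly m M) = σ (aeval (v : E) (formPoly m M)) :=
    aeval_algHom_apply (σ.restrictScalars F) (v : E) _
  have h2 : σ (formE E m M v) = formE E m M v := by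
    rw [← hQ, IsScalarTower.algebraMap_apply F (RatFunc F) E, AlgEquiv.commutes]
  rw [h1, ← map_pow, ← AlgEquiv.commutes σ, ← map_mul, ← map_add, ← formE_eq_aeval, h2, hQ]

theorem exists_smul_eq_one [CharP F 2] {V : Type*} [AddCommGroup V] [Module F V]
    {Q : QuadraticForm F V} {a : V} (ha : Q a ≠ 0) : ∃ c : F, c ≠ 0 ∧ Q (c • a) = 1 := by
  obtain ⟨c, hc⟩ := FiniteField.isSquare_of_char_two (ringChar.eq F 2 ▸ rfl) (Q a)⁻¹
  refine ⟨c, ?_, ?_⟩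
  · rintro rfl
    simp [ha] at hc
  · rw [QuadraticMap.map_smul, ← hc, smul_eq_mul, inv_mul_cancel₀ ha]

include hQ in
/-- One reflection in the image of the Galois group gives all of them, by transitivity on the
vectors with `Q(v) = 1`, and these generate the orthogonal group. -/
theorem range_rootRep_eq [CharP F 2] [IsSplittingField (RatFunc F) E (polyL m M)]
    (hm : 2 ≤ m) (hM : IsPalindrome m M) {a : rootSpaceL F E m M} (ha : Q a ≠ 0)
    (hrange : reflectionOf Q a ha ∈ (rootRep F E (polyL m M) (isQPolynomial_polyL m M)).range) :
    (rootRep F E (polyL m M) (isQPolynomial_polyL m M)).range = orthogonalGroup Q := by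
  have hminus := isMinusType hQ hm hM
  have := finite_rootSpaceL (E := E) hm hM
  refine le_antisymm ?_ (orthogonalGroup_le_of_reflectionOf_mem hminus.nondegenerate
    (fun S hS => hminus.two_mul_finrank_lt (by omega) S hS) _ fun b hb => ?_)
  · rintro _ ⟨σ, rfl⟩
    exact rootRep_mem_orthogonalGroup hQ σ
  · obtain ⟨c, hc, hca⟩ := exists_smul_eq_one ha
    obtain ⟨d, hd, hdb⟩ := exists_smul_eq_one hb
    obtain ⟨σ, hσ⟩ := exists_rootRep_apply_eq hQ hm hM _ _ hca hdb
    rw [← reflectionOf_smul hb hd (hdb ▸ one_ne_zero),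
      ← conj_reflectionOf (hca ▸ one_ne_zero) _ (rootRep_mem_orthogonalGroup hQ σ) hσ,
      reflectionOf_smul ha hc]
    exact mul_mem (mul_mem ⟨σ, rfl⟩ hrange) (inv_mem ⟨σ, rfl⟩)

end Galois

/-! ### Powers that are transvections -/

section FrobeniusModule

variable {F V k : Type*} [Field F] [AddCommGroup V] [Module F V] [CommRing k]
  [Algebra F k] {ρ : V →ₗ[F] k} {S : Module.End F V}

theorem map_pow_apply_eq_pow (hS : ∀ v, ρ (S v) = ρ v ^ Nat.card F) (i : ℕ) (v : V) :
    ρ ((S ^ i) v) = ρ v ^ (Nat.card F ^ i) := by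
  induction i with
  | zero => simp
  | succ i ih => rw [pow_succ', Module.End.mul_apply, hS, ih, ← pow_mul, pow_succ]

/-- If `S` becomes the `q`-power map under `ρ`, then a polynomial `p` in `S` becomes the
`q`-polynomial with conventional associate `p`. -/
theorem map_aeval_apply (hS : ∀ v, ρ (S v) = ρ v ^ Nat.card F) (p : F[X]) (v : V) :
    ρ (aeval S p v) = aeval (ρ v) (qAssociate (Nat.card F) p) := by
  rw [aeval_qAssociate, aeval_eq_sum_range, LinearMap.sum_apply, map_sum]
  refine Finset.sum_congr rfl fun i _ => ?_
  rw [LinearMap.smul_apply, map_smul, map_pow_apply_eq_pow hS]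

variable [Finite F] [IsDomain k]

theorem card_ker_aeval_le (hρ : Function.Injective ρ) (hS : ∀ v, ρ (S v) = ρ v ^ Nat.card F)
    {p : F[X]} (hp : p ≠ 0) :
    Nat.card (LinearMap.ker (aeval S p)) ≤ Nat.card F ^ p.natDegree := by
  classical
  have hq : 1 < Nat.card F := Finite.one_lt_card
  have hinj := FaithfulSMul.algebraMap_injective F k
  have h0 : (qAssociate (Nat.card F) p).map (algebraMap F k) ≠ 0 := by
    rw [Polynomial.map_ne_zero_iff hinj]
    intro h
    have := coeff_qAssociate hq p p.natDegree
    rw [h, coeff_zero, coeff_natDegree, eq_comm, leadingCoeff_eq_zero] at this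
    exact hp this
  refine le_trans (b := ((qAssociate (Nat.card F) p).map (algebraMap F k)).roots.toFinset.card) ?_
    ((Multiset.toFinset_card_le _).trans ((card_roots' _).trans
    (natDegree_map_le.trans (natDegree_qAssociate_le hq p))))
  · rw [← Nat.card_eq_finsetCard]
    refine Nat.card_le_card_of_injective (fun v => ⟨ρ v, ?_⟩) fun v w h => ?_
    · rw [Multiset.mem_toFinset, mem_roots h0, IsRoot, eval_map_algebraMap, ← map_aeval_apply hS,
        LinearMap.mem_ker.1 v.2, map_zero]
    · exact Subtype.ext (hρ (congrArg Subtype.val h))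

theorem minpoly_eq_of_aeval_eq_zero [FiniteDimensional F V] (hρ : Function.Injective ρ)
    (hS : ∀ v, ρ (S v) = ρ v ^ Nat.card F)
    {M : F[X]} (hM : M.Monic) (hdeg : M.natDegree = Module.finrank F V) (hSM : aeval S M = 0) :
    minpoly F S = M := by
  have hmonic := minpoly.monic (Algebra.IsIntegral.isIntegral (R := F) S)
  refine (eq_of_monic_of_dvd_of_natDegree_le hmonic hM (minpoly.dvd F S hSM) ?_).symm
  have h := card_ker_aeval_le hρ hS hmonic.ne_zero
  rw [minpoly.aeval, LinearMap.ker_zero, Module.natCard_eq_pow_finrank (K := F), finrank_top,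
    Nat.pow_le_pow_iff_right Finite.one_lt_card] at h
  exact hdeg ▸ h

end FrobeniusModule

/-- A separable polynomial `D` over a finite field of characteristic two with `D(0) ≠ 0` divides
`x^k - 1` for some odd `k`. -/
theorem exists_dvd_X_pow_sub_one {F : Type*} [Field F] [Finite F] [CharP F 2] {D : F[X]}
    (hD : D.Monic) (hsep : D.Separable) (h0 : D.eval 0 ≠ 0) :
    ∃ k : ℕ, (k : F) ≠ 0 ∧ D ∣ X ^ k - 1 := by
  have : Module.Finite F (AdjoinRoot D) := hD.finite_adjoinRoot
  have : Finite (AdjoinRoot D) := Module.finite_of_finite F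
  have hcop : IsCoprime X D := by
    refine (irreducible_X.coprime_iff_not_dvd).2 fun h => h0 ?_
    rwa [X_dvd_iff, coeff_zero_eq_eval_zero] at h
  have hunit : IsUnit (AdjoinRoot.root D) := by
    obtain ⟨a, b, hab⟩ := hcop
    refine IsUnit.of_mul_eq_one_right (AdjoinRoot.mk D a) ?_
    rw [← AdjoinRoot.mk_X, ← map_mul, ← sub_eq_zero, ← map_one (AdjoinRoot.mk D), ← map_sub,
      AdjoinRoot.mk_eq_zero]
    exact ⟨-b, by linear_combination hab⟩
  obtain ⟨u, hu⟩ := hunit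
  obtain ⟨n, hn, hun⟩ := isOfFinOrder_iff_pow_eq_one.1 (isOfFinOrder_of_finite u)
  have hdvd : D ∣ X ^ n - 1 := by
    rw [← AdjoinRoot.mk_eq_zero, map_sub, map_pow, map_one, AdjoinRoot.mk_X, ← hu,
      ← Units.val_pow_eq_pow_val, hun, Units.val_one, sub_self]
  -- in characteristic two `x^(2^a k) - 1 = (x^k - 1)^(2^a)`
  obtain ⟨a, k, hk, rfl⟩ := Nat.exists_eq_two_pow_mul_odd hn.ne'
  have : Fact (Nat.Prime 2) := ⟨Nat.prime_two⟩
  refine ⟨k, ?_, ?_⟩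
  · rw [Ne, CharP.cast_eq_zero_iff F 2]
    exact hk.not_two_dvd_nat
  · rw [mul_comm, pow_mul, ← one_pow (2 ^ a), ← sub_pow_char_pow] at hdvd
    exact (hsep.squarefree.dvd_pow_iff_dvd (by simp)).1 hdvd

/-- If `S` has minimal polynomial `(x - 1) D` where `D` is separable with `D(0) ≠ 0` and
`D(1) = 0`, and the fixed space of `S` has dimension at most one, then some power of `S` is a
transvection. -/
theorem exists_pow_transvection {F V : Type*} [Field F] [Finite F] [CharP F 2] [AddCommGroup V]
    [Module F V] [FiniteDimensional F V] {S : Module.End F V} {D : F[X]} (hD : D.Monic)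
    (hsep : D.Separable) (h0 : D.eval 0 ≠ 0) (h1 : X - 1 ∣ D)
    (hS : minpoly F S = (X - 1) * D)
    (hfix : Module.finrank F (LinearMap.ker (S - 1)) ≤ 1) :
    ∃ k : ℕ, minpoly F (S ^ k) = (X - 1) ^ 2 ∧
      Module.finrank F (LinearMap.range (S ^ k - 1)) = 1 := by
  obtain ⟨k, hk, hDk⟩ := exists_dvd_X_pow_sub_one hD hsep h0
  have hae : aeval S (X ^ k - 1 : F[X]) = S ^ k - 1 := by simp
  have hX1 : (X - 1 : F[X]) = X - C 1 := by simp
  -- `k` is odd, so `x^k - 1` is squarefree and not divisible by `(x - 1)²`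
  have hne : S ^ k - 1 ≠ 0 := by
    intro h
    rw [← hae] at h
    have h2 : (X - 1) * (X - 1) ∣ (X ^ k - 1 : F[X]) :=
      (mul_dvd_mul_left _ h1).trans (hS ▸ minpoly.dvd F S h)
    have := (X_pow_sub_one_separable_iff.2 hk).squarefree _ h2
    rw [hX1] at this
    exact not_isUnit_X_sub_C _ this
  have hrange : LinearMap.range (S ^ k - 1) ≤ LinearMap.ker (S - 1) := by
    rintro _ ⟨v, rfl⟩
    have h : aeval S ((X - 1) * (X ^ k - 1) : F[X]) = 0 := by
      rw [← minpoly.dvd_iff, hS]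
      exact mul_dvd_mul_left _ hDk
    rw [map_mul, hae] at h
    simpa using LinearMap.congr_fun h v
  refine ⟨k, ?_, le_antisymm ((Submodule.finrank_mono hrange).trans hfix) ?_⟩
  · have hdvd : minpoly F (S ^ k) ∣ (X - C 1) ^ 2 := by
      rw [← hX1]
      refine minpoly.dvd F _ ?_
      have h : aeval S ((X ^ k - 1) * (X ^ k - 1) : F[X]) = 0 := by
        rw [← minpoly.dvd_iff, hS]
        exact mul_dvd_mul (h1.trans hDk) hDk
      rw [map_mul, hae] at h
      simpa [pow_two] using h
    obtain ⟨i, hi, hass⟩ := (dvd_prime_pow (prime_X_sub_C (1 : F)) 2).1 hdvd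
    have heq := eq_of_monic_of_associated
      (minpoly.monic (Algebra.IsIntegral.isIntegral (R := F) (S ^ k)))
      ((monic_X_sub_C (1 : F)).pow i) hass
    have hi2 : ¬ i ≤ 1 := by
      intro hi1
      apply hne
      have h : minpoly F (S ^ k) ∣ X - C 1 := by
        rw [heq]
        exact (pow_dvd_pow _ hi1).trans (pow_one (X - C (1 : F))).dvd
      simpa using minpoly.dvd_iff.1 h
    rw [heq, hX1, show i = 2 by omega]
  · rw [Nat.one_le_iff_ne_zero, Ne, Submodule.finrank_eq_zero, LinearMap.range_eq_bot]
    exact hne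

/-- The factorization `M = (x - 1) D` with `D` separable. -/
theorem exists_eq_X_sub_one_mul {F : Type*} [Field F] [Finite F] {M : F[X]} (hM : M.Monic)
    (hM0 : M.eval 0 ≠ 0) (hMone : M.rootMultiplicity 1 = 2)
    (hMsimple : HasSimpleRoots (M /ₘ (X - 1) ^ 2)) :
    ∃ D : F[X], D.Monic ∧ D.Separable ∧ D.eval 0 ≠ 0 ∧ X - 1 ∣ D ∧ M = (X - 1) * D := by
  have hX1 : (X - 1 : F[X]) = X - C 1 := by simp
  rw [hX1] at hMsimple ⊢
  have hfac := pow_mul_divByMonic_rootMultiplicity_eq M 1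
  have hN1 := eval_divByMonic_pow_rootMultiplicity_ne_zero 1 hM.ne_zero
  rw [hMone] at hfac hN1
  set N := M /ₘ (X - C 1) ^ 2 with hN
  have hMD : M = (X - C 1) * ((X - C 1) * N) := by rw [← hfac]; ring
  have hmonic : ((X - C 1) * N).Monic :=
    Monic.of_mul_monic_left (monic_X_sub_C 1) (hMD ▸ hM)
  have hN0 : N ≠ 0 := by rintro h; exact hN1 (by rw [h, eval_zero])
  refine ⟨(X - C 1) * N, hmonic, ?_, ?_, dvd_mul_right _ _, hMD⟩
  · refine (separable_X_sub_C).mul ?_ ?_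
    · rw [← separable_map (algebraMap F (AlgebraicClosure F))]
      exact (nodup_roots_iff_of_splits ((Polynomial.map_ne_zero_iff
        (algebraMap F (AlgebraicClosure F)).injective).2 hN0) (IsAlgClosed.splits _)).1 hMsimple
    · refine ((irreducible_X_sub_C (1 : F)).coprime_iff_not_dvd).2 fun h => hN1 ?_
      exact dvd_iff_isRoot.1 h
  · intro h
    apply hM0
    rw [hMD, eval_mul, h, mul_zero]

/-- If `S` becomes the `q`-power map on a space of roots of the `q`-polynomial with conventional
associate `M = (x - 1)² N`, then some power of `S` is a transvection. -/
theorem exists_pow_transvection_of_map {F V k : Type*} [Field F] [Finite F] [CharP F 2]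
    [AddCommGroup V] [Module F V] [FiniteDimensional F V] [CommRing k] [IsDomain k] [Algebra F k]
    {ρ : V →ₗ[F] k} {S : Module.End F V} (hρ : Function.Injective ρ)
    (hS : ∀ v, ρ (S v) = ρ v ^ Nat.card F) {M : F[X]} (hM : M.Monic)
    (hdeg : M.natDegree = Module.finrank F V) (hM0 : M.eval 0 ≠ 0)
    (hMone : M.rootMultiplicity 1 = 2) (hMsimple : HasSimpleRoots (M /ₘ (X - 1) ^ 2))
    (hroot : ∀ v, aeval (ρ v) (qAssociate (Nat.card F) M) = 0) :
    ∃ n : ℕ, minpoly F (S ^ n) = (X - 1) ^ 2 ∧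
      Module.finrank F (LinearMap.range (S ^ n - 1)) = 1 := by
  have hSM : aeval S M = 0 := by
    ext1 v
    apply hρ
    rw [map_aeval_apply hS, hroot, LinearMap.zero_apply, map_zero]
  obtain ⟨D, hD, hsep, hD0, hD1, hMD⟩ := exists_eq_X_sub_one_mul hM hM0 hMone hMsimple
  have hmin := minpoly_eq_of_aeval_eq_zero hρ hS hM hdeg hSM
  have hX1 : (X - 1 : F[X]) = X - C 1 := by simp
  -- a fixed vector of `S` maps to a root of `x^q - x`
  have hfix : Module.finrank F (LinearMap.ker (S - 1)) ≤ 1 := by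
    have h := card_ker_aeval_le hρ hS (p := X - 1) (hX1 ▸ X_sub_C_ne_zero 1)
    have hev : aeval S (X - C 1 : F[X]) = S - 1 := by simp
    rwa [hX1, natDegree_X_sub_C, hev, Module.natCard_eq_pow_finrank (K := F),
      Nat.pow_le_pow_iff_right Finite.one_lt_card] at h
  exact exists_pow_transvection hD hsep hD0 hD1 (hmin.trans hMD) hfix

/-! ### Frobenius elements at the prime `(t)` -/

section Reduction

/-- The polynomial `L` with its coefficients in `F[t]`. -/
noncomputable def integralPolyL {F : Type*} [Field F] (m : ℕ) (M : F[X]) : F[X][X] :=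
  (qAssociate (Nat.card F) M).map (algebraMap F F[X]) +
    C (X ^ Nat.card F) * X ^ (Nat.card F ^ (m + 1)) + C X * X ^ (Nat.card F ^ (m - 1))

theorem map_integralPolyL {F : Type*} [Field F] (m : ℕ) (M : F[X]) :
    (integralPolyL m M).map (algebraMap F[X] (RatFunc F)) = polyL m M := by
  simp only [integralPolyL, polyL, Polynomial.map_add, Polynomial.map_mul, Polynomial.map_pow,
    map_C, map_X, Polynomial.map_map, ← IsScalarTower.algebraMap_eq, map_pow,
    RatFunc.algebraMap_X]

theorem algebraMap_coeff_integralPolyL {F : Type*} [Field F] (m : ℕ) (M : F[X]) (i : ℕ) :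
    algebraMap F[X] (RatFunc F) ((integralPolyL m M).coeff i) = (polyL m M).coeff i := by
  rw [← map_integralPolyL, coeff_map]

variable {F : Type*} [Field F] [Finite F] {m : ℕ} {M : F[X]}

theorem coeff_zero_integralPolyL (m : ℕ) (M : F[X]) : (integralPolyL m M).coeff 0 = 0 := by
  apply IsFractionRing.injective F[X] (RatFunc F)
  rw [algebraMap_coeff_integralPolyL, map_zero, ← notMem_support_iff]
  intro h
  obtain ⟨j, hj⟩ := isQPolynomial_polyL m M 0 h
  exact pow_ne_zero j Nat.card_pos.ne' hj.symm

theorem coeff_one_integralPolyL (hm : 2 ≤ m) (hM : IsPalindrome m M) :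
    (integralPolyL m M).coeff 1 = 1 := by
  apply IsFractionRing.injective F[X] (RatFunc F)
  have h := congrArg (fun p => p.coeff 0) (derivative_polyL hm hM)
  simpa [coeff_derivative, algebraMap_coeff_integralPolyL] using h

theorem monic_integralPolyL (hm : 2 ≤ m) (hM : IsPalindrome m M) :
    (integralPolyL m M).Monic := by
  refine monic_of_injective (IsFractionRing.injective F[X] (RatFunc F)) ?_
  rw [map_integralPolyL]
  exact monic_polyL hm hM

/-- A root of `L` in a domain that reduces to zero is zero: modulo `x²`, the reduction of `L`
is still `x`. -/
theorem eq_zero_of_aeval_integralPolyL {R k : Type*} [CommRing R] [IsDomain R] [Algebra F[X] R]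
    [Ring k] [Nontrivial k] (ψ : R →+* k) (hm : 2 ≤ m) (hM : IsPalindrome m M) {r : R}
    (hr : ψ r = 0) (h : aeval r (integralPolyL m M) = 0) : r = 0 := by
  by_contra hr0
  have h1 := divX_mul_X_add (integralPolyL m M)
  have h2 := divX_mul_X_add (divX (integralPolyL m M))
  rw [coeff_zero_integralPolyL, map_zero, add_zero] at h1
  rw [coeff_divX, zero_add, coeff_one_integralPolyL hm hM, map_one] at h2
  rw [← h1, map_mul, aeval_X] at h
  have h3 := (mul_eq_zero.1 h).resolve_right hr0
  rw [← h2, map_add, map_mul, aeval_X, map_one] at h3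
  have h4 := congrArg ψ h3
  rw [map_add, map_mul, hr, mul_zero, zero_add, map_one, map_zero] at h4
  exact one_ne_zero h4

variable {E : Type*} [Field E] [Algebra (RatFunc F) E] [Algebra F E] [Algebra F[X] E]
  [IsScalarTower F[X] (RatFunc F) E]

theorem aeval_integralPolyL_eq_zero (v : rootSpaceL F E m M) :
    aeval (v : E) (integralPolyL m M) = 0 := by
  rw [← aeval_map_algebraMap (RatFunc F), map_integralPolyL]
  exact v.2

theorem isIntegral_of_mem_rootSpaceL (hm : 2 ≤ m) (hM : IsPalindrome m M)
    (v : rootSpaceL F E m M) : IsIntegral F[X] (v : E) :=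
  ⟨integralPolyL m M, monic_integralPolyL hm hM, aeval_integralPolyL_eq_zero v⟩

theorem aeval_mk_integralPolyL (hm : 2 ≤ m) (hM : IsPalindrome m M) (v : rootSpaceL F E m M) :
    aeval (⟨v, isIntegral_of_mem_rootSpaceL hm hM v⟩ : integralClosure F[X] E)
      (integralPolyL m M) = 0 := by
  apply Subtype.val_injective
  rw [← Subalgebra.aeval_coe]
  exact aeval_integralPolyL_eq_zero v

variable [IsScalarTower F F[X] E]

variable {k : Type*} [CommRing k] [Algebra F k] [Algebra F[X] k] [IsScalarTower F F[X] k]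
  (ψ : integralClosure F[X] E →ₐ[F[X]] k)

/-- The reduction `v ↦ ψ v` of the roots of `L`, where `ψ` is a homomorphism from the integral
closure of `F[t]` to an `F[t]`-algebra. -/
noncomputable def reduction (hm : 2 ≤ m) (hM : IsPalindrome m M) : rootSpaceL F E m M →ₗ[F] k where
  toFun v := ψ ⟨v, isIntegral_of_mem_rootSpaceL hm hM v⟩
  map_add' v w := map_add ψ ⟨v, isIntegral_of_mem_rootSpaceL hm hM v⟩
    ⟨w, isIntegral_of_mem_rootSpaceL hm hM w⟩
  map_smul' c v := (ψ.toLinearMap.restrictScalars F).map_smul c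
    ⟨v, isIntegral_of_mem_rootSpaceL hm hM v⟩

theorem reduction_injective [Nontrivial k] (hm : 2 ≤ m) (hM : IsPalindrome m M) :
    Function.Injective (reduction ψ hm hM) := by
  refine (injective_iff_map_eq_zero _).2 fun v hv => ?_
  have := eq_zero_of_aeval_integralPolyL (ψ : integralClosure F[X] E →+* k) hm hM hv
    (aeval_mk_integralPolyL hm hM v)
  have h := congrArg Subtype.val this
  exact Subtype.ext h

/-- Where `t` becomes zero, `L` reduces to `Φ`. -/
theorem aeval_reduction_qAssociate (hm : 2 ≤ m) (hM : IsPalindrome m M)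
    (hX : algebraMap F[X] k X = 0) (v : rootSpaceL F E m M) :
    aeval (reduction ψ hm hM v) (qAssociate (Nat.card F) M) = 0 := by
  have h : aeval (reduction ψ hm hM v) (integralPolyL m M) = 0 := by
    have := congrArg ψ (aeval_mk_integralPolyL hm hM v)
    rw [← aeval_algHom_apply, map_zero] at this
    exact this
  have hq : Nat.card F ≠ 0 := Nat.card_pos.ne'
  simpa only [integralPolyL, map_add, map_mul, map_pow, aeval_X, aeval_C, aeval_map_algebraMap, hX,
    zero_pow hq, zero_mul, add_zero] using h

variable {ψ} [IsScalarTower F (RatFunc F) E] {σ τ : E ≃ₐ[RatFunc F] E}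

/-- An automorphism inducing the `q`-power map on `k` induces it on the reductions of the
roots of `L`. -/
theorem reduction_rootRep (hm : 2 ≤ m) (hM : IsPalindrome m M)
    (hσ : ∀ x, ψ ((σ.restrictScalars F[X]).mapIntegralClosure x) = ψ x ^ Nat.card F)
    (v : rootSpaceL F E m M) :
    reduction ψ hm hM (rootRep F E (polyL m M) (isQPolynomial_polyL m M) σ v) =
      reduction ψ hm hM v ^ Nat.card F :=
  hσ ⟨v, isIntegral_of_mem_rootSpaceL hm hM v⟩

theorem eq_of_forall_map_eq_pow [Nontrivial k] [IsSplittingField (RatFunc F) E (polyL m M)]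
    (hm : 2 ≤ m) (hM : IsPalindrome m M)
    (hσ : ∀ x, ψ ((σ.restrictScalars F[X]).mapIntegralClosure x) = ψ x ^ Nat.card F)
    (hτ : ∀ x, ψ ((τ.restrictScalars F[X]).mapIntegralClosure x) = ψ x ^ Nat.card F) : σ = τ := by
  refine rootRep_injective F E m M (LinearEquiv.ext fun v => reduction_injective ψ hm hM ?_)
  rw [reduction_rootRep hm hM hσ, reduction_rootRep hm hM hτ]

theorem exists_pow_rootRep_transvection [CharP F 2] [IsDomain k]
    [IsSplittingField (RatFunc F) E (polyL m M)]
    (hm : 2 ≤ m) (hM : IsPalindrome m M) (hMone : M.rootMultiplicity 1 = 2)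
    (hMsimple : HasSimpleRoots (M /ₘ (X - 1) ^ 2))
    {Q : QuadraticForm F (rootSpaceL F E m M)} (hQ : ∀ v, algebraMap F E (Q v) = formE E m M v)
    (hX : algebraMap F[X] k X = 0)
    (hσ : ∀ x, ψ ((σ.restrictScalars F[X]).mapIntegralClosure x) = ψ x ^ Nat.card F) :
    ∃ n : ℕ, IsOrthogonalTransvection Q
      (rootRep F E (polyL m M) (isQPolynomial_polyL m M) (σ ^ n)) := by
  have := finite_rootSpaceL (E := E) hm hM
  obtain ⟨n, hn1, hn2⟩ := exists_pow_transvection_of_map (ρ := reduction ψ hm hM)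
    (S := (rootRep F E (polyL m M) (isQPolynomial_polyL m M) σ).toLinearMap)
    (reduction_injective ψ hm hM) (reduction_rootRep hm hM hσ)
    hM.monic (hM.natDegree_eq.trans (finrank_rootSpaceL hm hM).symm)
    (by rw [← coeff_zero_eq_eval_zero, hM.coeff_zero]; exact one_ne_zero) hMone hMsimple
    (aeval_reduction_qAssociate ψ hm hM hX)
  have hpow : (rootRep F E (polyL m M) (isQPolynomial_polyL m M) (σ ^ n)).toLinearMap =
      (rootRep F E (polyL m M) (isQPolynomial_polyL m M) σ).toLinearMap ^ n := by
    rw [map_pow]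
    exact map_pow (LinearEquiv.automorphismGroup.toLinearMapMonoidHom) _ n
  rw [← hpow] at hn1 hn2
  exact ⟨n, rootRep_mem_orthogonalGroup hQ _, hn1, hn2⟩

end Reduction

section FrobeniusClass

open scoped Pointwise

variable {F : Type*} [Field F] {E : Type*} [Field E] [Algebra (RatFunc F) E]
  [Algebra F[X] E] [IsScalarTower F[X] (RatFunc F) E]

instance smulCommClass_galois : SMulCommClass (E ≃ₐ[RatFunc F] E) F[X] E :=
  ⟨fun σ p x => by
    simp only [AlgEquiv.smul_def]
    exact map_smul (σ.restrictScalars F[X]) p x⟩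

/-- The invariants of the Galois group in the integral closure of `F[t]` are `F[t]`. -/
theorem isInvariant_integralClosure [FiniteDimensional (RatFunc F) E] [IsGalois (RatFunc F) E] :
    Algebra.IsInvariant F[X] (integralClosure F[X] E) (E ≃ₐ[RatFunc F] E) := by
  refine ⟨fun x hx => ?_⟩
  obtain ⟨y, hy⟩ := (IsGalois.mem_range_algebraMap_iff_fixed (F := RatFunc F) (x : E)).2
    fun σ => congrArg Subtype.val (hx σ)
  have hint : IsIntegral F[X] y := by
    rw [← isIntegral_algebraMap_iff (FaithfulSMul.algebraMap_injective (RatFunc F) E), hy]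
    exact x.2
  obtain ⟨a, rfl⟩ := IsIntegrallyClosed.algebraMap_eq_of_integral hint
  refine ⟨a, Subtype.ext ?_⟩
  rw [← hy, ← IsScalarTower.algebraMap_apply]
  rfl

theorem card_quotient_under {F E : Type*} [Field F] [Field E] [Algebra F[X] E]
    {J : Ideal (integralClosure F[X] E)}
    (hJ : J.under F[X] = Ideal.span {X - C 0}) : Nat.card (F[X] ⧸ J.under F[X]) = Nat.card F := by
  rw [hJ]
  exact Nat.card_congr (quotientSpanXSubCAlgEquiv (0 : F)).toEquiv

/-- A Frobenius element at `J` induces the `q`-power map on the residue ring of `J`. -/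
theorem mkₐ_map_eq_pow {J : Ideal (integralClosure F[X] E)}
    (hJ : J.under F[X] = Ideal.span {X - C 0}) {σ : E ≃ₐ[RatFunc F] E}
    (hσ : ((σ.restrictScalars F[X]).mapIntegralClosure.toAlgHom).IsArithFrobAt J)
    (x : integralClosure F[X] E) :
    Ideal.Quotient.mkₐ F[X] J ((σ.restrictScalars F[X]).mapIntegralClosure x) =
      Ideal.Quotient.mkₐ F[X] J x ^ Nat.card F := by
  rw [← card_quotient_under hJ]
  exact hσ.mk_apply x

/-- Every Frobenius element at `(t)` has a power acting on `V` as a transvection. -/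
theorem exists_pow_transvection_of_mem_frobeniusClass [Finite F] [CharP F 2] {m : ℕ} {M : F[X]}
    [Algebra F E] [IsScalarTower F (RatFunc F) E] [IsScalarTower F F[X] E]
    [IsSplittingField (RatFunc F) E (polyL m M)]
    (hm : 2 ≤ m) (hM : IsPalindrome m M) (hMone : M.rootMultiplicity 1 = 2)
    (hMsimple : HasSimpleRoots (M /ₘ (X - 1) ^ 2))
    {Q : QuadraticForm F (rootSpaceL F E m M)} (hQ : ∀ v, algebraMap F E (Q v) = formE E m M v)
    {σ : E ≃ₐ[RatFunc F] E} (hσ : σ ∈ frobeniusClass F E 0) :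
    ∃ n : ℕ, IsOrthogonalTransvection Q
      (rootRep F E (polyL m M) (isQPolynomial_polyL m M) (σ ^ n)) := by
  obtain ⟨J, hJ, hJX, hσJ⟩ := hσ
  refine exists_pow_rootRep_transvection (k := integralClosure F[X] E ⧸ J)
    (ψ := Ideal.Quotient.mkₐ F[X] J) hm hM hMone hMsimple hQ ?_ (mkₐ_map_eq_pow hJX hσJ)
  refine Ideal.Quotient.eq_zero_iff_mem.2 (?_ : X ∈ J.under F[X])
  rw [hJX, map_zero, sub_zero]
  exact Ideal.mem_span_singleton_self X

/-- The prime `(t)` is unramified, since reduction is injective on the roots of `L`; so its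
Frobenius elements form one conjugacy class. -/
theorem exists_conjClasses_carrier_eq [Finite F] {m : ℕ} {M : F[X]} [Algebra F E]
    [IsScalarTower F (RatFunc F) E] [IsScalarTower F F[X] E] [IsSplittingField (RatFunc F) E (polyL m M)]
    (hm : 2 ≤ m) (hM : IsPalindrome m M) :
    ∃ 𝒞 : ConjClasses (E ≃ₐ[RatFunc F] E), 𝒞.carrier = frobeniusClass F E 0 := by
  have := isGalois_of_isSplittingField_polyL (E := E) hm hM
  have : FiniteDimensional (RatFunc F) E := IsSplittingField.finiteDimensional E (polyL m M)
  have hinv := isInvariant_integralClosure (F := F) (E := E)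
  have hfin : Module.Finite F[X] (integralClosure F[X] E) :=
    IsIntegralClosure.finite F[X] (RatFunc F) E (integralClosure F[X] E)
  have hmax : (Ideal.span {X - C 0} : Ideal F[X]).IsMaximal :=
    PrincipalIdealRing.isMaximal_of_irreducible (irreducible_X_sub_C 0)
  have : FaithfulSMul F[X] (integralClosure F[X] E) := by
    rw [faithfulSMul_iff_algebraMap_injective]
    intro a b hab
    have h := congrArg Subtype.val hab
    change algebraMap F[X] E a = algebraMap F[X] E b at h
    rw [IsScalarTower.algebraMap_apply F[X] (RatFunc F) E,
      IsScalarTower.algebraMap_apply F[X] (RatFunc F) E] at h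
    exact IsFractionRing.injective F[X] (RatFunc F) ((algebraMap (RatFunc F) E).injective h)
  obtain ⟨J, hJ, hJX⟩ := Ideal.exists_maximal_ideal_liesOver_of_isIntegral
    (S := integralClosure F[X] E) (Ideal.span {X - C 0} : Ideal F[X])
  have hJX' : J.under F[X] = Ideal.span {X - C 0} := hJX.over.symm
  have : Finite (integralClosure F[X] E ⧸ J) := by
    have : Finite (F[X] ⧸ (Ideal.span {X - C 0} : Ideal F[X])) :=
      Finite.of_equiv F (quotientSpanXSubCAlgEquiv (0 : F)).symm.toEquiv
    exact Module.finite_of_finite (F[X] ⧸ (Ideal.span {X - C 0} : Ideal F[X]))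
  obtain ⟨σ₀, hσ₀⟩ := IsArithFrobAt.exists_of_isInvariant F[X] (E ≃ₐ[RatFunc F] E) J
  refine ⟨ConjClasses.mk σ₀, Set.ext fun τ => ?_⟩
  rw [ConjClasses.mem_carrier_iff_mk_eq, ConjClasses.mk_eq_mk_iff_isConj, isConj_comm, isConj_iff]
  constructor
  · rintro ⟨g, rfl⟩
    exact ⟨g • J, inferInstance, (Ideal.under_smul (A := F[X]) J g).trans hJX', hσ₀.conj g⟩
  · rintro ⟨J', hJ', hJX'', hτ⟩
    obtain ⟨g, rfl⟩ := Algebra.IsInvariant.exists_smul_of_under_eq F[X] (integralClosure F[X] E)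
      (E ≃ₐ[RatFunc F] E) J J' (hJX'.trans hJX''.symm)
    -- `g⁻¹ τ g` is a Frobenius element at `J`, like `σ₀`
    have hτ' : IsArithFrobAt F[X] τ (g • J) := hτ
    have hconj := hτ'.conj g⁻¹
    rw [inv_smul_smul, inv_inv] at hconj
    refine ⟨g, ?_⟩
    have : Nontrivial (integralClosure F[X] E ⧸ J) := Ideal.Quotient.nontrivial_iff.2 hJ.ne_top
    rw [eq_of_forall_map_eq_pow (σ := σ₀) (τ := g⁻¹ * τ * g) hm hM (mkₐ_map_eq_pow hJX' hσ₀)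
      (mkₐ_map_eq_pow hJX' hconj)]
    group

end FrobeniusClass

end OrthGal

theorem mainTheorem3 {F : Type*} [Field F] [Finite F] (hF : Even (Nat.card F))
    (m : ℕ) (hm : 2 ≤ m) (M : Polynomial F) (hMmonic : M.Monic) (hMdeg : M.natDegree = 2 * m)
    (hMrec : OrthGal.IsSelfReciprocal M) (hMone : M.rootMultiplicity 1 = 2)
    (hMsimple : OrthGal.HasSimpleRoots (M /ₘ (Polynomial.X - 1) ^ 2))
    {E : Type*} [Field E] [Algebra (RatFunc F) E]
    [Algebra F E] [IsScalarTower F (RatFunc F) E]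
    [Algebra (Polynomial F) E] [IsScalarTower (Polynomial F) (RatFunc F) E]
    [Polynomial.IsSplittingField (RatFunc F) E (OrthGal.polyL m M)] :
    M.coeff 0 = 1 ∧ (∀ i ≤ 2 * m, M.coeff i = M.coeff (2 * m - i)) ∧ M.coeff m = 0 ∧
    IsGalois (RatFunc F) E ∧
    Function.Injective
      (OrthGal.rootRep F E (OrthGal.polyL m M) (OrthGal.isQPolynomial_polyL m M)) ∧
    ∃ Q : QuadraticForm F
        (OrthGal.rootSpace F E (OrthGal.polyL m M) (OrthGal.isQPolynomial_polyL m M)),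
      OrthGal.IsMinusType m Q ∧
      (OrthGal.rootRep F E (OrthGal.polyL m M) (OrthGal.isQPolynomial_polyL m M)).range =
        OrthGal.orthogonalGroup Q ∧
      ∃ 𝒞 : ConjClasses (E ≃ₐ[RatFunc F] E), 𝒞.carrier = OrthGal.frobeniusClass F E 0 ∧
        ∀ σ ∈ 𝒞.carrier, ∃ k : ℕ, OrthGal.IsOrthogonalTransvection Q
          (OrthGal.rootRep F E (OrthGal.polyL m M) (OrthGal.isQPolynomial_polyL m M) (σ ^ k)) := by
  have : CharP F 2 := by
    have := Fintype.ofFinite F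
    rw [Nat.card_eq_fintype_card, Nat.even_iff, ← FiniteField.even_card_iff_char_two] at hF
    exact ringChar.of_eq hF
  have : IsScalarTower F (Polynomial F) E := IsScalarTower.of_algebraMap_eq fun a => by
    rw [IsScalarTower.algebraMap_apply F (RatFunc F) E,
      IsScalarTower.algebraMap_apply F (Polynomial F) (RatFunc F),
      ← IsScalarTower.algebraMap_apply (Polynomial F) (RatFunc F) E]
  have hsymm : ∀ i ≤ 2 * m, M.coeff i = M.coeff (2 * m - i) := fun i hi =>
    OrthGal.coeff_eq_coeff_sub hMmonic hMdeg hMrec hi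
  have hone : M.eval 1 = 0 :=
    (Polynomial.rootMultiplicity_pos hMmonic.ne_zero).1 (by rw [hMone]; exact two_pos)
  have hmid : M.coeff m = 0 := OrthGal.coeff_middle_eq_zero hMdeg hsymm hone
  have hM : OrthGal.IsPalindrome m M := ⟨hMmonic, hMdeg, hsymm, hmid⟩
  obtain ⟨Q, hQ⟩ := OrthGal.exists_formV (E := E) hm hM
  have hminus := OrthGal.isMinusType hQ hm hM
  obtain ⟨𝒞, h𝒞⟩ := OrthGal.exists_conjClasses_carrier_eq (E := E) hm hM
  have htrans : ∀ σ ∈ 𝒞.carrier, ∃ k : ℕ, OrthGal.IsOrthogonalTransvection Q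
      (OrthGal.rootRep F E (OrthGal.polyL m M) (OrthGal.isQPolynomial_polyL m M) (σ ^ k)) :=
    fun σ hσ => OrthGal.exists_pow_transvection_of_mem_frobeniusClass hm hM hMone hMsimple hQ
      (h𝒞 ▸ hσ)
  refine ⟨hM.coeff_zero, hsymm, hmid, OrthGal.isGalois_of_isSplittingField_polyL hm hM,
    OrthGal.rootRep_injective F E m M, Q, hminus, ?_, 𝒞, h𝒞, htrans⟩
  obtain ⟨σ, rfl⟩ := ConjClasses.mk_surjective 𝒞
  obtain ⟨k, hk, -, hrank⟩ := htrans σ ConjClasses.mem_carrier_mk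
  obtain ⟨a, ha, hka⟩ := OrthGal.exists_eq_reflectionOf hminus.nondegenerate hk hrank
  exact OrthGal.range_rootRep_eq hQ hm hM ha ⟨σ ^ k, hka⟩
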